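/- **Definitions.** A *Ricci flow spacetime* $(\mathcal M^{n+1},\mathfrak t,\partial_t,g)$ with time interval $I$ (an open interval of $\mathbb R$) consists of a smooth connected $(n+1)$-manifold $\mathcal M$ without boundary (Hausdorff and second countable), a smooth submersion $\mathfrak t:\mathcal M\to I$ onto $I$, a smooth vector field $\partial_t$ on $\mathcal M$ with $\partial_t(\mathfrak t)\equiv 1$, and a smooth inner product $g$ on the bundle $\ker(d\mathfrak t)$ which satisfies $\mathcal L_{\partial_t}g=-2\,\mathrm{Ric}(g)$, where $\mathrm{Ric}(g)$ is the Ricci tensor of the Riemannian metric $g(t)$ that $g$ induces on the time slice $\mathcal M_t=\mathfrak t^{-1}(t)$. The *worldline* of $x\in\mathcal M$ is the maximal integral curve $I_x\to\mathcal M$, $t\mapsto x(t)$, of $\partial_t$ with $x(\mathfrak t(x))=x$. A spacetime with $I=(0,T)$, $0<T\le\infty$, is *expanding* if $\sup I_x=T$ for all $x\in\mathcal M$. **Theorem.** Let $n\ge 0$ and let $(\mathcal M^{n+1},\mathfrak t,\partial_t,g)$ be an expanding Ricci flow spacetime with $I=(0,T)$. Then there exist a smooth connected $n$-manifold $M$ (Hausdorff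 and second countable) and a smooth map $\Phi:\mathcal M\to M\times(0,T)$ such that 1. $\Phi$ is a diffeomorphism onto its image, which is open in $M\times(0,T)$; 2. for each $t\in(0,T)$, the restriction $\Phi:\mathcal M_t\to M\times\{t\}$ is a diffeomorphism onto its image, which is open in $M\times\{t\}$; 3. if $t:M\times(0,T)\to(0,T)$ denotes the projection, then $\mathfrak t=t\circ\Phi$ and $\Phi_*(\partial_t)=\frac{\partial}{\partial t}$; 4. $\Phi_*(g)$ is a smooth family of Riemannian metrics $h(t)$ on the (open, nonempty) slices $\{p\in M:(p,t)\in\Phi(\mathcal M)\}$, $t\in(0,T)$, which solves the Ricci flow equation $\frac{\partial h}{\partial t}(t)=-2\,\mathrm{Ric}(h(t))$ at every point of $\Phi(\mathcal M)$; 5. $M$ is the direct limit of the time slices along the flow of $\partial_t$: writing $f$ for the first component of $\Phi$, one has $M=\bigcup_{t\in(0,T)}f(\mathcal M_t)$, and for $x,y\in\mathcal M$ one has $f(x)=f(y)$ if and only if $y=x(t)$ for some $t\in I_x$. -/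

import Mathlib

open Set Manifold
open scoped Manifold ContDiff Topology

universe u

noncomputable section

namespace RicciSpacetime

/-! ### Ricci curvature in local coordinates -/

/-- The partial derivative `∂f/∂xₖ` at `y`. -/
def pderiv {n : ℕ} (k : Fin n) (f : EuclideanSpace ℝ (Fin n) → ℝ)
    (y : EuclideanSpace ℝ (Fin n)) : ℝ :=
  fderiv ℝ f y (EuclideanSpace.single k 1)

/-- The Christoffel symbol `Γᵏᵢⱼ = ½ ∑ₗ gᵏˡ (∂ᵢ gⱼₗ + ∂ⱼ gᵢₗ - ∂ₗ gᵢⱼ)` of a metric given by the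
matrix of its coefficients. -/
def christoffel {n : ℕ} (G : EuclideanSpace ℝ (Fin n) → Matrix (Fin n) (Fin n) ℝ)
    (k i j : Fin n) (y : EuclideanSpace ℝ (Fin n)) : ℝ :=
  (1 / 2 : ℝ) * ∑ l, (G y)⁻¹ k l *
    (pderiv i (fun z => G z j l) y + pderiv j (fun z => G z i l) y
      - pderiv l (fun z => G z i j) y)

/-- The coefficients of the Ricci tensor in coordinates:
`Rᵢⱼ = ∑ₖ (∂ₖ Γᵏᵢⱼ - ∂ⱼ Γᵏᵢₖ) + ∑ₖₗ (Γᵏₖₗ Γˡᵢⱼ - Γᵏⱼₗ Γˡᵢₖ)`. -/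
def ricciCoeff {n : ℕ} (G : EuclideanSpace ℝ (Fin n) → Matrix (Fin n) (Fin n) ℝ)
    (y : EuclideanSpace ℝ (Fin n)) (i j : Fin n) : ℝ :=
  ∑ k, (pderiv k (christoffel G k i j) y - pderiv j (christoffel G k i k) y)
    + ∑ k, ∑ l, (christoffel G k k l y * christoffel G l i j y
      - christoffel G k j l y * christoffel G l i k y)

/-- The Ricci tensor at `y` of a metric with coefficients `G`, applied to two vectors. -/
def ricciCoord {n : ℕ} (G : EuclideanSpace ℝ (Fin n) → Matrix (Fin n) (Fin n) ℝ)
    (y a b : EuclideanSpace ℝ (Fin n)) : ℝ :=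
  ∑ i, ∑ j, a i * b j * ricciCoeff G y i j

/-! ### Smooth vector fields and diffeomorphisms onto open images -/

/-- The vector field `X` is smooth on the set `W`. -/
def SmoothFieldOn {m : ℕ} {N : Type u} [TopologicalSpace N]
    [ChartedSpace (EuclideanSpace ℝ (Fin m)) N] [IsManifold (𝓡 m) ∞ N]
    (X : ∀ p : N, TangentSpace (𝓡 m) p) (W : Set N) : Prop :=
  ContMDiffOn (𝓡 m) (𝓡 m).tangent ∞ (fun p => (⟨p, X p⟩ : TangentBundle (𝓡 m) N)) W

/-- The restriction of `f` to `s` is a diffeomorphism onto its image, which is open in the target.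
(When `s` is an embedded submanifold, a map into `s` is smooth if and only if it is smooth as a map
into the surrounding manifold.) -/
def IsDiffeoOntoOpenImageOn {E E' H H' : Type*} [NormedAddCommGroup E] [NormedSpace ℝ E]
    [NormedAddCommGroup E'] [NormedSpace ℝ E'] [TopologicalSpace H] [TopologicalSpace H']
    (I : ModelWithCorners ℝ E H) (J : ModelWithCorners ℝ E' H')
    {N N' : Type*} [TopologicalSpace N] [ChartedSpace H N]
    [TopologicalSpace N'] [ChartedSpace H' N'] (s : Set N) (f : N → N') : Prop :=
  ContMDiffOn I J ∞ f s ∧ IsOpen (f '' s) ∧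
    ∃ h : N' → N, ContMDiffOn J I ∞ h (f '' s) ∧ ∀ x ∈ s, h (f x) = x

/-! ### Ricci flow on an open subset of an ambient space `M × I` -/

section Ambient

variable {n : ℕ} {M : Type u} [TopologicalSpace M] [ChartedSpace (EuclideanSpace ℝ (Fin n)) M]

/-- The coefficients, in the chart of `M` around `p`, of a field `h` of bilinear forms. -/
def chartCoeff (h : ∀ p : M, LinearMap.BilinForm ℝ (TangentSpace (𝓡 n) p)) (p : M)
    (y : EuclideanSpace ℝ (Fin n)) : Matrix (Fin n) (Fin n) ℝ :=
  Matrix.of fun i j =>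
    h ((extChartAt (𝓡 n) p).symm y)
      (mfderiv (𝓡 n) (𝓡 n) (extChartAt (𝓡 n) p).symm y (EuclideanSpace.single i (1 : ℝ)))
      (mfderiv (𝓡 n) (𝓡 n) (extChartAt (𝓡 n) p).symm y (EuclideanSpace.single j (1 : ℝ)))

/-- The Ricci tensor at `p` of a Riemannian metric `h` defined near `p`. -/
def ricci (h : ∀ p : M, LinearMap.BilinForm ℝ (TangentSpace (𝓡 n) p)) (p : M)
    (v w : TangentSpace (𝓡 n) p) : ℝ :=
  ricciCoord (chartCoeff h p) (extChartAt (𝓡 n) p p)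
    (mfderiv (𝓡 n) (𝓡 n) (extChartAt (𝓡 n) p) p v)
    (mfderiv (𝓡 n) (𝓡 n) (extChartAt (𝓡 n) p) p w)

/-- `𝒰` is an open subset of `M × I` all of whose time slices are nonempty, and `h t` is a smooth
family of Riemannian metrics on the slices `{p | (p, t) ∈ 𝒰}` with `∂h/∂t = -2 Ric(h(t))` on `𝒰`.
The values of `h` off `𝒰` are irrelevant. -/
structure IsRicciFlowOn [IsManifold (𝓡 n) ∞ M] (I : Set ℝ) (𝒰 : Set (M × ℝ))
    (h : ℝ → ∀ p : M, LinearMap.BilinForm ℝ (TangentSpace (𝓡 n) p)) : Prop where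
  isOpen : IsOpen 𝒰
  subset : 𝒰 ⊆ univ ×ˢ I
  slice_nonempty : ∀ t ∈ I, ∃ p, (p, t) ∈ 𝒰
  symm : ∀ p t, (p, t) ∈ 𝒰 → ∀ v w, h t p v w = h t p w v
  pos : ∀ p t, (p, t) ∈ 𝒰 → ∀ v, v ≠ 0 → 0 < h t p v v
  smooth : ∀ (W : Set M) (X Y : ∀ p : M, TangentSpace (𝓡 n) p), IsOpen W →
    SmoothFieldOn X W → SmoothFieldOn Y W →
    ContMDiffOn ((𝓡 n).prod 𝓘(ℝ, ℝ)) 𝓘(ℝ, ℝ) ∞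
      (fun z : M × ℝ => h z.2 z.1 (X z.1) (Y z.1)) (𝒰 ∩ W ×ˢ univ)
  flow : ∀ p t, (p, t) ∈ 𝒰 → ∀ v w,
    HasDerivAt (fun s => h s p v w) (-2 * ricci (h t) p v w) t

end Ambient

/-! ### Ricci flow spacetimes -/

section Spacetime

variable {n : ℕ} {𝓜 : Type u} [TopologicalSpace 𝓜]
  [ChartedSpace (EuclideanSpace ℝ (Fin (n + 1))) 𝓜]

variable (n) in
/-- The space of spatial vectors `ker(d𝔱)` at `x`. -/
def spat (time : 𝓜 → ℝ) (x : 𝓜) : Submodule ℝ (TangentSpace (𝓡 (n + 1)) x) :=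
  LinearMap.ker (mvfderiv (𝓡 (n + 1)) time x : TangentSpace (𝓡 (n + 1)) x →ₗ[ℝ] ℝ)

variable (n 𝓜) in
/-- A time function, a time vector field and a spatial metric on a smooth `(n+1)`-manifold. -/
structure PreSpacetime [IsManifold (𝓡 (n + 1)) ∞ 𝓜] (I : Set ℝ) where
  /-- the time function `𝔱` -/
  time : 𝓜 → ℝ
  /-- the time vector field `∂_t` -/
  dt : ∀ x : 𝓜, TangentSpace (𝓡 (n + 1)) x
  /-- the inner product on `ker(d𝔱)` -/
  g : ∀ x : 𝓜, LinearMap.BilinForm ℝ (spat n time x)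
  isOpen_interval : IsOpen I
  ordConnected_interval : I.OrdConnected
  time_smooth : ContMDiff (𝓡 (n + 1)) 𝓘(ℝ, ℝ) ∞ time
  time_range : range time = I
  time_submersion : ∀ x, Function.Surjective (mvfderiv (𝓡 (n + 1)) time x)
  dt_smooth : SmoothFieldOn dt univ
  dt_time : ∀ x, mvfderiv (𝓡 (n + 1)) time x (dt x) = 1
  g_symm : ∀ x v w, g x v w = g x w v
  g_pos : ∀ x v, v ≠ 0 → 0 < g x v v
  g_smooth : ∀ (W : Set 𝓜) (X Y : ∀ x : 𝓜, spat n time x), IsOpen W →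
    SmoothFieldOn (fun x => (X x : TangentSpace (𝓡 (n + 1)) x)) W →
    SmoothFieldOn (fun x => (Y x : TangentSpace (𝓡 (n + 1)) x)) W →
    ContMDiffOn (𝓡 (n + 1)) 𝓘(ℝ, ℝ) ∞ (fun x => g x (X x) (Y x)) W

namespace PreSpacetime

variable [IsManifold (𝓡 (n + 1)) ∞ 𝓜] {I : Set ℝ} (S : PreSpacetime n 𝓜 I)

/-- The projection `v ↦ v - d𝔱(v) ∂_t` onto `ker(d𝔱)` along `∂_t`; it fixes spatial vectors. -/
def proj (x : 𝓜) (v : TangentSpace (𝓡 (n + 1)) x) : spat n S.time x :=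
  ⟨v - mvfderiv (𝓡 (n + 1)) S.time x v • S.dt x, by simp [spat, S.dt_time x]⟩

/-- The spatial inner product as a function of two tangent vectors of `𝓜`. It is only ever used on
spatial vectors, where it agrees with `g`. -/
def met (x : 𝓜) (v w : TangentSpace (𝓡 (n + 1)) x) : ℝ := S.g x (S.proj x v) (S.proj x w)

/-- The time slice `𝓜_t`. -/
def slice (t : ℝ) : Set 𝓜 := {x | S.time x = t}

/-- The Lie derivative of `g` along `∂_t` at `x`, on spatial vector fields:
`(ℒ_{∂_t} g)(X, Y) = ∂_t (g(X, Y)) - g([∂_t, X], Y) - g(X, [∂_t, Y])`. -/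
def lieDerivMetric (X Y : ∀ x : 𝓜, spat n S.time x) (x : 𝓜) : ℝ :=
  mvfderiv (𝓡 (n + 1)) (fun z => S.g z (X z) (Y z)) x (S.dt x)
    - S.met x (VectorField.mlieBracket (𝓡 (n + 1)) S.dt (fun z => (X z).1) x) (Y x).1
    - S.met x (X x).1 (VectorField.mlieBracket (𝓡 (n + 1)) S.dt (fun z => (Y z).1) x)

/-- `φ` is a local parametrization of the slice `𝓜_t` over the open set `V ⊆ ℝⁿ`: an immersion
into that `n`-dimensional slice. -/
structure IsSliceParam (t : ℝ) (V : Set (EuclideanSpace ℝ (Fin n)))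
    (φ : EuclideanSpace ℝ (Fin n) → 𝓜) : Prop where
  isOpen : IsOpen V
  smooth : ContMDiffOn (𝓡 n) (𝓡 (n + 1)) ∞ φ V
  mem_slice : ∀ y ∈ V, φ y ∈ S.slice t
  immersion : ∀ y ∈ V, Function.Injective (mfderiv (𝓡 n) (𝓡 (n + 1)) φ y)

/-- The coefficients of the metric of a slice in a local parametrization `φ`. -/
def paramCoeff (φ : EuclideanSpace ℝ (Fin n) → 𝓜) (y : EuclideanSpace ℝ (Fin n)) :
    Matrix (Fin n) (Fin n) ℝ :=
  Matrix.of fun i j =>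
    S.met (φ y) (mfderiv (𝓡 n) (𝓡 (n + 1)) φ y (EuclideanSpace.single i (1 : ℝ)))
      (mfderiv (𝓡 n) (𝓡 (n + 1)) φ y (EuclideanSpace.single j (1 : ℝ)))

/-- The equation `ℒ_{∂_t} g = -2 Ric(g)`, where `Ric(g)` is the Ricci tensor of the slices, computed
in local parametrizations of the slices. -/
def RicciFlowEquation : Prop :=
  ∀ (t : ℝ) (V : Set (EuclideanSpace ℝ (Fin n))) (φ : EuclideanSpace ℝ (Fin n) → 𝓜),
    S.IsSliceParam t V φ → ∀ y ∈ V, ∀ (W : Set 𝓜) (X Y : ∀ x : 𝓜, spat n S.time x),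
    IsOpen W → φ y ∈ W →
    SmoothFieldOn (fun x => (X x : TangentSpace (𝓡 (n + 1)) x)) W →
    SmoothFieldOn (fun x => (Y x : TangentSpace (𝓡 (n + 1)) x)) W →
    ∀ a b : EuclideanSpace ℝ (Fin n),
      mfderiv (𝓡 n) (𝓡 (n + 1)) φ y a = (X (φ y)).1 →
      mfderiv (𝓡 n) (𝓡 (n + 1)) φ y b = (Y (φ y)).1 →
      S.lieDerivMetric X Y (φ y) = -2 * ricciCoord (S.paramCoeff φ) y a b

/-- `y = x(t)`: the worldline of `x` (the maximal integral curve of `∂_t` with value `x` at time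
`𝔱(x)`) is defined at time `t` and takes the value `y` there. -/
def WorldlineAt (x : 𝓜) (t : ℝ) (y : 𝓜) : Prop :=
  ∃ (J : Set ℝ) (γ : ℝ → 𝓜), IsOpen J ∧ J.OrdConnected ∧ S.time x ∈ J ∧ t ∈ J ∧
    IsMIntegralCurveOn γ S.dt J ∧ γ (S.time x) = x ∧ γ t = y

/-- The domain `I_x` of the worldline of `x`. -/
def worldlineDomain (x : 𝓜) : Set ℝ := {t | ∃ y, S.WorldlineAt x t y}

/-- The vanishing time `T_x = sup I_x`, in the extended reals. -/
def vanishingTime (x : 𝓜) : EReal := sSup ((fun t : ℝ => (t : EReal)) '' S.worldlineDomain x)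

end PreSpacetime

variable (n 𝓜) in
/-- A Ricci flow spacetime with time interval `I` on the (connected) manifold `𝓜`. -/
structure RicciFlowSpacetime [IsManifold (𝓡 (n + 1)) ∞ 𝓜] (I : Set ℝ)
    extends PreSpacetime n 𝓜 I where
  ricciFlow : toPreSpacetime.RicciFlowEquation

end Spacetime

/-- The interval `(0, T)`, where `T = ∞` is allowed. -/
def timeInterval (T : EReal) : Set ℝ := {t : ℝ | 0 < t ∧ (t : EReal) < T}

/-- A spacetime with time interval `(0, T)` is expanding: every worldline lasts until time `T`. -/
def IsExpanding {n : ℕ} {𝓜 : Type u} [TopologicalSpace 𝓜]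
    [ChartedSpace (EuclideanSpace ℝ (Fin (n + 1))) 𝓜] [IsManifold (𝓡 (n + 1)) ∞ 𝓜] {T : EReal}
    (S : RicciFlowSpacetime n 𝓜 (timeInterval T)) : Prop :=
  ∀ x, S.vanishingTime x = T

end RicciSpacetime

end

/-!
The manifold `M` is the space of worldlines, that is, the quotient of `𝓜` by the relation of lying
on a common integral curve of `∂_t`, and `Φ` sends `x` to the pair (worldline of `x`, `𝔱 x`). By
the flow box theorem `𝓜` is covered by coordinates `(y, t)` with last coordinate field `∂_t`; the
spatial part `y` of such a box is a chart of `M`. Following worldlines from one box to another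
gives smooth germs (the holonomy), so that the quotient map is open and the transition maps of `M`
are smooth. A worldline is determined by its point in any slice it meets, so `Φ` is injective, and
flow boxes give local inverses. Expansion is what makes `M` Hausdorff: two worldlines both reach
the later of the times of two of their points, where they meet a slice, itself Hausdorff and
mapped homeomorphically to an open set.

Lifting a coordinate field of `M` to a spatial field on `𝓜` gives a field commuting with `∂_t`. On
such fields the Lie derivative of `g` is therefore the time derivative of the coefficients of the
pushed forward metric, and the Ricci flow equation for `g` becomes the one for `h`.

The smooth local flow of a vector field `v`, needed for flow boxes, comes from the inverse
function theorem applied to the integral equation `γ = x + s ∫ v(γ)` on the Banach space of curves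
on `[-1, 1]`.
-/

noncomputable section

namespace RicciSpacetime

/-! ### Smooth local flows -/

section Postcomp

variable {K : Type*} [TopologicalSpace K] [CompactSpace K]

/-- Pointwise application of a continuous family of operators to a continuous family of vectors. -/
def applyCLM (K : Type*) [TopologicalSpace K] [CompactSpace K] (E F : Type*)
    [NormedAddCommGroup E] [NormedSpace ℝ E] [NormedAddCommGroup F] [NormedSpace ℝ F] :
    C(K, E →L[ℝ] F) →L[ℝ] C(K, E) →L[ℝ] C(K, F) :=
  LinearMap.mkContinuous₂
    (LinearMap.mk₂ ℝ (fun (A : C(K, E →L[ℝ] F)) (h : C(K, E)) =>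
        (⟨fun t => A t (h t), by fun_prop⟩ : C(K, F)))
      (fun _ _ _ => by ext; simp) (fun _ _ _ => by ext; simp)
      (fun _ _ _ => by ext; simp) (fun _ _ _ => by ext; simp)) 1
    (fun A h => by
      rw [one_mul]
      refine (ContinuousMap.norm_le _ (by positivity)).2 fun t => ?_
      exact (A t).le_of_opNorm_le_of_le (A.norm_coe_le_norm t) (h.norm_coe_le_norm t))

theorem hasFDerivAt_postcomp {E F : Type*} [NormedAddCommGroup E] [NormedSpace ℝ E]
    [NormedAddCommGroup F] [NormedSpace ℝ F] (f : C(E, F)) (f' : C(E, E →L[ℝ] F))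
    (hf : ∀ x, HasFDerivAt f (f' x) x) (γ : C(K, E)) :
    HasFDerivAt (fun γ : C(K, E) => f.comp γ) (applyCLM K E F (f'.comp γ)) γ := by
  rw [hasFDerivAt_iff_isLittleO_nhds_zero, Asymptotics.isLittleO_iff]
  intro ε hε
  have hcont : Continuous fun γ : C(K, E) => f'.comp γ := ContinuousMap.continuous_postcomp f'
  obtain ⟨δ, hδ, hf'δ⟩ := (Metric.continuousAt_iff (f := fun γ : C(K, E) => f'.comp γ)).1
    (hcont.continuousAt (x := γ)) ε hε
  -- Perturbing `γ` by constants makes the continuity of `f'` uniform along `γ`.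
  have hf'_near : ∀ t, ∀ y ∈ Metric.ball (γ t) δ, ‖f' y - f' (γ t)‖ ≤ ε := by
    intro t y hy
    have hdist : dist (γ + ContinuousMap.const K (y - γ t)) γ < δ := by
      rw [dist_eq_norm, add_sub_cancel_left]
      exact (ContinuousMap.norm_lt_iff _ hδ).2 fun _ => mem_ball_iff_norm.1 hy
    simpa [dist_eq_norm] using ((ContinuousMap.dist_lt_iff hε).1 (hf'δ hdist) t).le
  filter_upwards [Metric.ball_mem_nhds (0 : C(K, E)) hδ] with h hh
  refine (ContinuousMap.norm_le _ (by positivity)).2 fun t => ?_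
  have hmem : γ t + h t ∈ Metric.ball (γ t) δ := by
    simpa [dist_eq_norm] using (h.norm_coe_le_norm t).trans_lt (mem_ball_zero_iff.1 hh)
  have hmean := (convex_ball (γ t) δ).norm_image_sub_le_of_norm_hasFDerivWithin_le'
    (fun y _ => (hf y).hasFDerivWithinAt) (hf'_near t) (Metric.mem_ball_self hδ) hmem
  rw [add_sub_cancel_left] at hmean
  exact hmean.trans (mul_le_mul_of_nonneg_left (h.norm_coe_le_norm t) hε.le)

theorem contDiff_postcomp_nat {E : Type u} [NormedAddCommGroup E] [NormedSpace ℝ E] (m : ℕ) :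
    ∀ {F : Type u} [NormedAddCommGroup F] [NormedSpace ℝ F] (f : C(E, F)),
      ContDiff ℝ m f → ContDiff ℝ m (fun γ : C(K, E) => f.comp γ) := by
  induction m with
  | zero => exact fun f _ => contDiff_zero.2 (ContinuousMap.continuous_postcomp f)
  | succ m ih =>
    intro F _ _ f hf
    have hf' : ContDiff ℝ m (fderiv ℝ f) := hf.fderiv_right (by simp)
    let f' : C(E, E →L[ℝ] F) := ⟨fderiv ℝ f, hf'.continuous⟩
    exact contDiff_succ_iff_hasFDerivAt.2 ⟨fun γ => applyCLM K E F (f'.comp γ),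
      ContDiff.comp (g := applyCLM K E F) (ContinuousLinearMap.contDiff _) (ih f' hf'),
      hasFDerivAt_postcomp f f' fun x => (hf.differentiable (by simp) x).hasFDerivAt⟩

theorem contDiff_postcomp {E F : Type u} [NormedAddCommGroup E] [NormedSpace ℝ E]
    [NormedAddCommGroup F] [NormedSpace ℝ F] {k : ℕ∞} {f : C(E, F)} (hf : ContDiff ℝ k f) :
    ContDiff ℝ k (fun γ : C(K, E) => f.comp γ) :=
  contDiff_iff_forall_nat_le.2 fun m hm =>
    contDiff_postcomp_nat m f (hf.of_le (by exact_mod_cast hm))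

end Postcomp

theorem exists_openPartialHomeomorph_of_contDiffOn {𝕜 E F : Type*} [RCLike 𝕜]
    [NormedAddCommGroup E] [NormedSpace 𝕜 E] [CompleteSpace E] [NormedAddCommGroup F]
    [NormedSpace 𝕜 F] {k : WithTop ℕ∞} (hk : k ≠ 0) {f : E → F} {U : Set E}
    (hU : IsOpen U) (hf : ContDiffOn 𝕜 k f U) {a : E} (ha : a ∈ U) {f' : E ≃L[𝕜] F}
    (hf' : HasFDerivAt f (f' : E →L[𝕜] F) a) :
    ∃ e : OpenPartialHomeomorph E F, a ∈ e.source ∧ e.source ⊆ U ∧ (e : E → F) = f ∧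
      ContDiffOn 𝕜 k e.symm e.target := by
  have hfa : ContDiffAt 𝕜 k f a := hf.contDiffAt (hU.mem_nhds ha)
  let s : Set E := U ∩ fderiv 𝕜 f ⁻¹' range ((↑) : (E ≃L[𝕜] F) → E →L[𝕜] F)
  have hs : IsOpen s :=
    (hf.continuousOn_fderiv_of_isOpen hU
      (ENat.one_le_iff_ne_zero_withTop.2 hk)).isOpen_inter_preimage hU ContinuousLinearEquiv.isOpen
  let e := (hfa.toOpenPartialHomeomorph f hf' hk).restrOpen s hs
  refine ⟨e, ⟨hfa.mem_toOpenPartialHomeomorph_source hf' hk, ha, f', hf'.fderiv.symm⟩,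
    fun z hz => hz.2.1, rfl, fun y hy => ?_⟩
  obtain ⟨-, hmem, A, hA⟩ := e.map_target hy
  have hfy := hf.contDiffAt (hU.mem_nhds hmem)
  refine (e.contDiffAt_symm (f₀' := A) hy ?_ hfy).contDiffWithinAt
  exact hA ▸ (hfy.differentiableAt hk).hasFDerivAt

section Flow

variable {E : Type u} [NormedAddCommGroup E]

/-- The interval on which the solution curves of the flow construction are parametrized; it is
symmetric so that the flow is obtained for both signs of time. -/
abbrev TimeBall : Set ℝ := Icc (-1) 1

theorem neg_one_le_one_real : (-1 : ℝ) ≤ 1 := by norm_num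

/-- The extension of a curve on `[-1, 1]` to the real line by constants. -/
def extendCurve (γ : C(TimeBall, E)) : C(ℝ, E) := γ.IccExtend neg_one_le_one_real

theorem extendCurve_of_mem (γ : C(TimeBall, E)) {t : ℝ} (ht : t ∈ TimeBall) :
    extendCurve γ t = γ ⟨t, ht⟩ := IccExtend_of_mem _ _ ht

theorem norm_extendCurve_le (γ : C(TimeBall, E)) (t : ℝ) : ‖extendCurve γ t‖ ≤ ‖γ‖ :=
  γ.norm_coe_le_norm _

/-- The curve `t ↦ γ(ct)`, meant for `c ∈ [-1, 1]`. -/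
def rescaleCurve (c : ℝ) (γ : C(TimeBall, E)) : C(TimeBall, E) :=
  ⟨fun t => extendCurve γ (c * t), by fun_prop⟩

theorem dist_rescaleCurve_const_lt {c : ℝ} {γ : C(TimeBall, E)} {x : E} {η : ℝ} (hη : 0 < η)
    (hγ : dist γ (.const _ x) < η) : dist (rescaleCurve c γ) (.const _ x) < η :=
  (ContinuousMap.dist_lt_iff hη).2 fun _ => (ContinuousMap.dist_lt_iff hη).1 hγ _

variable [NormedSpace ℝ E]

/-- The primitive, vanishing at `0`, of a curve on `[-1, 1]`. -/
def primitiveCLM (E : Type*) [NormedAddCommGroup E] [NormedSpace ℝ E] :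
    C(TimeBall, E) →L[ℝ] C(TimeBall, E) :=
  LinearMap.mkContinuous
    { toFun := fun γ => ⟨fun t => ∫ τ in (0 : ℝ)..t, extendCurve γ τ,
        (intervalIntegral.continuous_primitive
          (fun a b => (extendCurve γ).continuous.intervalIntegrable a b) 0).comp
            continuous_subtype_val⟩
      map_add' := fun γ₁ γ₂ => by
        ext t
        exact intervalIntegral.integral_add ((extendCurve γ₁).continuous.intervalIntegrable _ _)
          ((extendCurve γ₂).continuous.intervalIntegrable _ _)
      map_smul' := fun c γ => by
        ext t
        exact intervalIntegral.integral_smul c _ } 1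
    (fun γ => by
      rw [one_mul]
      refine (ContinuousMap.norm_le _ (norm_nonneg _)).2 fun t => ?_
      refine (intervalIntegral.norm_integral_le_of_norm_le_const
        fun τ _ => norm_extendCurve_le γ τ).trans ?_
      rw [sub_zero]
      exact mul_le_of_le_one_right (norm_nonneg _) (abs_le.2 t.2))

/-- The integral equation on `[-1, 1]` for `γ' = s v(γ)`, `γ(0) = x`. -/
def IsFlowLine (v : C(E, E)) (x : E) (s : ℝ) (γ : C(TimeBall, E)) : Prop :=
  ∀ t : TimeBall, γ t = x + s • ∫ τ in (0 : ℝ)..t, v (extendCurve γ τ)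

theorem mul_mem_timeBall {c t : ℝ} (hc : c ∈ TimeBall) (ht : t ∈ TimeBall) :
    c * t ∈ TimeBall := by
  refine abs_le.1 ?_
  rw [abs_mul]
  exact mul_le_one₀ (abs_le.2 hc) (abs_nonneg t) (abs_le.2 ht)

namespace IsFlowLine

variable {v : C(E, E)} {x : E} {s : ℝ} {γ : C(TimeBall, E)}

theorem rescale (hγ : IsFlowLine v x s γ) {c : ℝ} (hc : c ∈ TimeBall) :
    IsFlowLine v x (c * s) (rescaleCurve c γ) := by
  intro t
  have hsubst : ∫ τ in (0 : ℝ)..t, v (extendCurve (rescaleCurve c γ) τ)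
      = ∫ τ in (0 : ℝ)..t, v (extendCurve γ (c * τ)) := by
    refine intervalIntegral.integral_congr fun τ hτ => ?_
    have hτ' : τ ∈ TimeBall := uIcc_subset_Icc (by simp) t.2 hτ
    simp only [extendCurve_of_mem _ hτ']
    rfl
  calc rescaleCurve c γ t
      = x + s • ∫ τ in (c * 0)..(c * t), v (extendCurve γ τ) := by
        rw [mul_zero]
        exact (extendCurve_of_mem γ (mul_mem_timeBall hc t.2)).trans (hγ _)
    _ = x + (c * s) • ∫ τ in (0 : ℝ)..t, v (extendCurve (rescaleCurve c γ) τ) := by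
        rw [← intervalIntegral.smul_integral_comp_mul_left (fun τ => v (extendCurve γ τ)),
          hsubst, smul_smul, mul_comm]

variable [CompleteSpace E]

theorem hasDerivAt (hγ : IsFlowLine v x s γ) {t : ℝ} (ht : t ∈ Ioo (-1 : ℝ) 1) :
    HasDerivAt (extendCurve γ) (s • v (extendCurve γ t)) t := by
  have hcont : Continuous fun τ => v (extendCurve γ τ) := by fun_prop
  have hint := ((hcont.integral_hasStrictDerivAt 0 t).hasDerivAt.const_smul s).const_add x
  refine hint.congr_of_eventuallyEq ?_
  filter_upwards [Ioo_mem_nhds ht.1 ht.2] with τ hτ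
  exact (extendCurve_of_mem γ (Ioo_subset_Icc_self hτ)).trans (hγ _)

end IsFlowLine

/-- The map whose zeros in the second component are the flow lines of `v`. -/
def odeMap (v : C(E, E)) (q : (E × ℝ) × C(TimeBall, E)) : (E × ℝ) × C(TimeBall, E) :=
  (q.1, q.2 - ContinuousLinearMap.const ℝ TimeBall q.1.1 - q.1.2 • primitiveCLM E (v.comp q.2))

theorem odeMap_eq_iff {v : C(E, E)} {x : E} {s : ℝ} {γ : C(TimeBall, E)} :
    odeMap v ((x, s), γ) = ((x, s), 0) ↔ IsFlowLine v x s γ := by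
  simp only [odeMap, Prod.mk.injEq, true_and, sub_sub, sub_eq_zero]
  exact ContinuousMap.ext_iff

variable {k : ℕ∞}

theorem contDiff_primitiveCLM_postcomp {v : C(E, E)} (hv : ContDiff ℝ k v) :
    ContDiff ℝ k fun γ : C(TimeBall, E) => primitiveCLM E (v.comp γ) :=
  ContDiff.comp (g := primitiveCLM E) (ContinuousLinearMap.contDiff _) (contDiff_postcomp hv)

theorem contDiff_odeMap {v : C(E, E)} (hv : ContDiff ℝ k v) : ContDiff ℝ k (odeMap v) := by
  have := (contDiff_primitiveCLM_postcomp hv).comp (contDiff_snd (E := E × ℝ))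
  unfold odeMap
  fun_prop

theorem hasFDerivAt_odeMap {v : C(E, E)} (hv : ContDiff ℝ 1 v) (x : E) :
    ∃ A : ((E × ℝ) × C(TimeBall, E)) ≃L[ℝ] ((E × ℝ) × C(TimeBall, E)),
      HasFDerivAt (odeMap v) (A : _ →L[ℝ] _) ((x, 0), ContinuousMap.const _ x) := by
  set q₀ : (E × ℝ) × C(TimeBall, E) := ((x, 0), ContinuousMap.const _ x)
  let constCLM : E →L[ℝ] C(TimeBall, E) := ContinuousLinearMap.const ℝ TimeBall
  let B : E × ℝ →L[ℝ] C(TimeBall, E) :=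
    -(constCLM.comp (.fst ℝ E ℝ)) - (ContinuousLinearMap.snd ℝ E ℝ).smulRight
      (primitiveCLM E (v.comp q₀.2))
  refine ⟨(ContinuousLinearEquiv.refl ℝ _).skewProd (ContinuousLinearEquiv.refl ℝ _) B, ?_⟩
  have hprim := (((contDiff_primitiveCLM_postcomp (k := 1) hv).differentiable (by simp)
    q₀.2).hasFDerivAt).comp q₀ hasFDerivAt_snd
  have htime := (hasFDerivAt_snd (𝕜 := ℝ) (p := q₀.1)).comp q₀ hasFDerivAt_fst
  have hconst := (constCLM.comp (.fst ℝ E ℝ)).hasFDerivAt.comp q₀ hasFDerivAt_fst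
  refine (hasFDerivAt_fst.prodMk
    ((hasFDerivAt_snd.sub hconst).sub (htime.smul hprim))).congr_fderiv ?_
  ext q
  all_goals simp [q₀, B, constCLM, sub_eq_add_neg]

variable [CompleteSpace E]

theorem exists_contDiffOn_isFlowLine {v : C(E, E)} (hk : k ≠ 0) (hv : ContDiff ℝ k v) (x₀ : E) :
    ∃ Γ : E × ℝ → C(TimeBall, E), ∃ r > 0, ∃ η > 0, ContDiffOn ℝ k Γ (Metric.ball (x₀, 0) r) ∧
      ∀ x s, (x, s) ∈ Metric.ball (x₀, (0 : ℝ)) r →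
        IsFlowLine v x s (Γ (x, s)) ∧ dist (Γ (x, s)) (.const _ x₀) < η ∧
        ∀ γ, IsFlowLine v x s γ → dist γ (.const _ x₀) < η → γ = Γ (x, s) := by
  obtain ⟨A, hA⟩ := hasFDerivAt_odeMap (hv.of_le (ENat.one_le_iff_ne_zero_withTop.2 (by simpa))) x₀
  obtain ⟨e, hmem, -, he, hsymm⟩ := exists_openPartialHomeomorph_of_contDiffOn (k := k)
    (by simpa) isOpen_univ (contDiff_odeMap hv).contDiffOn (mem_univ _) hA
  obtain ⟨η, hη, hη_source⟩ := Metric.isOpen_iff.1 e.open_source _ hmem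
  have he₀ : e ((x₀, 0), .const _ x₀) = ((x₀, 0), 0) := by
    rw [he, odeMap_eq_iff]
    simp [IsFlowLine]
  have htarget := he₀ ▸ e.map_source hmem
  have hslice : ContinuousAt (fun q : E × ℝ => (q, (0 : C(TimeBall, E)))) (x₀, 0) := by fun_prop
  have hcont := (e.continuousAt_symm htarget).comp (x := (x₀, (0 : ℝ))) hslice
  have hnear : ∀ᶠ q in 𝓝 (x₀, (0 : ℝ)), (q, 0) ∈ e.target ∧
      e.symm (q, 0) ∈ Metric.ball ((x₀, 0), .const _ x₀) η := by
    refine (hslice.eventually_mem (e.open_target.mem_nhds htarget)).and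
      (hcont.eventually_mem ?_)
    rw [Function.comp_apply, ← he₀, e.left_inv hmem]
    exact Metric.ball_mem_nhds _ hη
  obtain ⟨r, hr, hball⟩ := Metric.eventually_nhds_iff_ball.1
    (hnear.and (Metric.ball_mem_nhds _ hη))
  refine ⟨fun q => (e.symm (q, 0)).2, r, hr, η, hη, ContDiffOn.snd (hsymm.comp (by fun_prop)
    fun q hq => (hball q hq).1.1), fun x s hxs => ?_⟩
  obtain ⟨⟨hxs_target, hxs_symm⟩, hxs_η⟩ := hball _ hxs
  rw [← ball_prod_same] at hxs_symm
  refine ⟨?_, hxs_symm.2, fun γ hγ hdist => ?_⟩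
  · have hright : odeMap v (e.symm ((x, s), 0)) = ((x, s), 0) := he ▸ e.right_inv hxs_target
    have hfst : (e.symm ((x, s), 0)).1 = (x, s) := congrArg Prod.fst hright
    rwa [← Prod.mk.eta (p := e.symm ((x, s), 0)), hfst, odeMap_eq_iff] at hright
  · have hsource : ((x, s), γ) ∈ e.source := hη_source (by
      rw [← ball_prod_same]
      exact ⟨hxs_η, hdist⟩)
    simp only [← odeMap_eq_iff.2 hγ, ← he, e.left_inv hsource]

theorem exists_contDiffOn_isFlowLine_rescale {v : C(E, E)} (hk : k ≠ 0) (hv : ContDiff ℝ k v)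
    (x₀ : E) :
    ∃ Γ : E × ℝ → C(TimeBall, E), ∃ r > 0, ContDiffOn ℝ k Γ (Metric.ball (x₀, 0) r) ∧
      ∀ x s, (x, s) ∈ Metric.ball (x₀, (0 : ℝ)) r → IsFlowLine v x s (Γ (x, s)) ∧
        ∀ c ∈ TimeBall, Γ (x, c * s) = rescaleCurve c (Γ (x, s)) := by
  obtain ⟨Γ, r, hr, η, hη, hΓ, hline⟩ := exists_contDiffOn_isFlowLine hk hv x₀
  refine ⟨Γ, r, hr, hΓ, fun x s hxs => ⟨(hline x s hxs).1, fun c hc => ?_⟩⟩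
  obtain ⟨hsol, hdist, -⟩ := hline x s hxs
  have hcs : (x, c * s) ∈ Metric.ball (x₀, (0 : ℝ)) r := by
    rw [← ball_prod_same, mem_prod, mem_ball_zero_iff] at hxs ⊢
    rw [norm_mul]
    exact ⟨hxs.1, (mul_le_of_le_one_left (norm_nonneg s) (abs_le.2 hc)).trans_lt hxs.2⟩
  exact ((hline x _ hcs).2.2 _ (hsol.rescale hc) (dist_rescaleCurve_const_lt hη hdist)).symm

theorem exists_contDiffOn_flow {v : E → E} (hk : k ≠ 0) (hv : ContDiff ℝ k v) (x₀ : E) :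
    ∃ α : E × ℝ → E, ∃ r > 0, ContDiffOn ℝ k α (Metric.ball (x₀, 0) r) ∧
      ∀ x s, (x, s) ∈ Metric.ball (x₀, (0 : ℝ)) r →
        α (x, 0) = x ∧ HasDerivAt (fun s => α (x, s)) (v (α (x, s))) s := by
  obtain ⟨Γ, r, hr, hΓ, hline⟩ :=
    exists_contDiffOn_isFlowLine_rescale (v := ⟨v, hv.continuous⟩) hk hv x₀
  have hone : (1 : ℝ) ∈ TimeBall := by simp
  have hscale : ∀ x s, (x, s) ∈ Metric.ball (x₀, (0 : ℝ)) r → ∀ c ∈ TimeBall,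
      Γ (x, c * s) ⟨1, hone⟩ = extendCurve (Γ (x, s)) c := by
    intro x s hxs c hc
    rw [(hline x s hxs).2 c hc]
    exact congrArg (extendCurve (Γ (x, s))) (mul_one c)
  refine ⟨fun q => Γ q ⟨1, hone⟩, r, hr, ?_, fun x s hxs => ⟨?_, ?_⟩⟩
  · exact ContDiff.comp_contDiffOn (g := ContinuousMap.evalCLM ℝ (⟨1, hone⟩ : TimeBall))
      (ContinuousLinearMap.contDiff _) hΓ
  · simpa [extendCurve_of_mem, (hline x s hxs).1 _] using hscale x s hxs 0 (by simp)
  · rw [← ball_prod_same, mem_prod, mem_ball_zero_iff] at hxs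
    obtain ⟨s', hs', hs'r⟩ := exists_between hxs.2
    have hs'_pos : 0 < s' := (norm_nonneg s).trans_lt hs'
    have hxs' : (x, s') ∈ Metric.ball (x₀, (0 : ℝ)) r := by
      rw [← ball_prod_same, mem_prod, mem_ball_zero_iff, Real.norm_of_nonneg hs'_pos.le]
      exact ⟨hxs.1, hs'r⟩
    have hmem : ∀ σ, |σ| < s' → σ / s' ∈ Ioo (-1 : ℝ) 1 := fun σ hσ => by
      rw [mem_Ioo, ← abs_lt, abs_div, abs_of_pos hs'_pos]
      exact (div_lt_one hs'_pos).2 hσ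
    have heq : ∀ σ, |σ| < s' → Γ (x, σ) ⟨1, hone⟩ = extendCurve (Γ (x, s')) (σ / s') := by
      intro σ hσ
      rw [← hscale x s' hxs' _ (Ioo_subset_Icc_self (hmem σ hσ)), div_mul_cancel₀ _ hs'_pos.ne']
    have hderiv := ((hline x s' hxs').1.hasDerivAt (hmem s hs')).scomp s
      ((hasDerivAt_id s).div_const s')
    rw [smul_smul, one_div_mul_cancel hs'_pos.ne', one_smul] at hderiv
    simp only [heq s hs']
    refine hderiv.congr_of_eventuallyEq ?_
    filter_upwards [continuous_abs.continuousAt.eventually_lt_const hs'] with σ hσ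
    exact heq σ hσ

end Flow

/-! ### Straightening a vector field -/

section FlowBox

variable {E F G : Type*} [NormedAddCommGroup E] [NormedSpace ℝ E] [NormedAddCommGroup F]
  [NormedSpace ℝ F] [NormedAddCommGroup G] [NormedSpace ℝ G]

theorem exists_contDiff_eqOn_ball [FiniteDimensional ℝ E] {k : ℕ∞} {U : Set E} (hU : IsOpen U)
    {v : E → F} (hv : ContDiffOn ℝ k v U) {x₀ : E} (hx₀ : x₀ ∈ U) :
    ∃ w : E → F, ContDiff ℝ k w ∧ ∃ ρ > 0, Metric.ball x₀ ρ ⊆ U ∧ EqOn w v (Metric.ball x₀ ρ) := by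
  obtain ⟨R, hR, hRU⟩ := Metric.nhds_basis_closedBall.mem_iff.1 (hU.mem_nhds hx₀)
  let χ : ContDiffBump x₀ := ⟨R / 2, R, half_pos hR, half_lt_self hR⟩
  refine ⟨fun z => χ z • v z, ?_, R / 2, half_pos hR, ?_, fun z hz => ?_⟩
  · refine contMDiff_iff_contDiff.1 (contMDiff_of_tsupport fun z hz => ?_)
    have hzU : z ∈ U := hRU (χ.tsupport_eq ▸ tsupport_smul_subset_left χ v hz)
    exact (χ.contDiff.contDiffAt.smul (hv.contDiffAt (hU.mem_nhds hzU))).contMDiffAt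
  · exact ((Metric.ball_subset_ball (half_le_self hR.le)).trans
      Metric.ball_subset_closedBall).trans hRU
  · simp only [χ.one_of_mem_closedBall (Metric.ball_subset_closedBall hz), one_smul]

theorem exists_prod_equiv_of_apply_eq_one [FiniteDimensional ℝ E] [FiniteDimensional ℝ F]
    (hEF : Module.finrank ℝ F + 1 = Module.finrank ℝ E) (l : E →L[ℝ] ℝ) {v : E} (hv : l v = 1) :
    ∃ A : (F × ℝ) ≃L[ℝ] E, (∀ q, l (A q) = q.2) ∧ A (0, 1) = v := by
  let e := ContinuousLinearEquiv.equivOfRightInverse l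
    ((1 : ℝ →L[ℝ] ℝ).smulRight v) fun c => by simp [hv]
  have hker : Module.finrank ℝ F = Module.finrank ℝ l.ker := by
    have := e.toLinearEquiv.finrank_eq
    rw [Module.finrank_prod, Module.finrank_self] at this
    omega
  let A : (F × ℝ) ≃L[ℝ] E := ((ContinuousLinearEquiv.prodComm ℝ F ℝ).trans
    ((ContinuousLinearEquiv.refl ℝ ℝ).prodCongr (.ofFinrankEq hker))).trans e.symm
  have hA : ∀ q, A q = q.2 • v + ContinuousLinearEquiv.ofFinrankEq hker q.1 := fun q => rfl
  exact ⟨A, fun q => by simp [hA, hv], by simp [hA]⟩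

theorem fderiv_symm_fderiv_apply {e : OpenPartialHomeomorph E F} {x : E} (hx : x ∈ e.source)
    (he : DifferentiableAt ℝ e x) (he' : DifferentiableAt ℝ e.symm (e x)) (u : E) :
    fderiv ℝ e.symm (e x) (fderiv ℝ e x u) = u := by
  have hcomp := he'.hasFDerivAt.comp x he.hasFDerivAt
  have hid := (hasFDerivAt_id (𝕜 := ℝ) x).congr_of_eventuallyEq (e.eventually_left_inverse hx)
  exact DFunLike.congr_fun (hcomp.unique hid) u

/-- `e` is a smooth coordinate system in which the vector field `v` is the last coordinate field. -/
structure Straightens (v : E → E) (e : OpenPartialHomeomorph E (F × ℝ)) : Prop where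
  contDiffOn : ContDiffOn ℝ ∞ e e.source
  contDiffOn_symm : ContDiffOn ℝ ∞ e.symm e.target
  fderiv_apply : ∀ z ∈ e.source, fderiv ℝ e z (v z) = (0, 1)

theorem exists_flowOut {E F : Type u} [NormedAddCommGroup E] [NormedSpace ℝ E]
    [NormedAddCommGroup F] [NormedSpace ℝ F] [FiniteDimensional ℝ E] {U : Set E} (hU : IsOpen U)
    {v : E → E} (hv : ContDiffOn ℝ ∞ v U) {x₀ : E} (hx₀ : x₀ ∈ U) (A : (F × ℝ) →L[ℝ] E)
    (hA : A (0, 1) = v x₀) :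
    ∃ (ψ : F × ℝ → E) (O : Set (F × ℝ)), IsOpen O ∧ 0 ∈ O ∧ ContDiffOn ℝ ∞ ψ O ∧
      MapsTo ψ O U ∧ ψ 0 = x₀ ∧ (∀ q ∈ O, fderiv ℝ ψ q (0, 1) = v (ψ q)) ∧
      HasFDerivAt ψ A 0 := by
  obtain ⟨w, hw, ρ, hρ, hρU, hwv⟩ := exists_contDiff_eqOn_ball (k := ⊤) hU hv hx₀
  obtain ⟨α, r, hr, hα, hflow⟩ := exists_contDiffOn_flow (k := ⊤) (by simp) hw x₀
  let a : F × ℝ → E × ℝ := fun q => (x₀ + A (q.1, 0), q.2)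
  have ha : ContDiff ℝ ∞ a := by fun_prop
  let O₁ : Set (F × ℝ) := a ⁻¹' Metric.ball (x₀, 0) r
  have hO₁ : IsOpen O₁ := Metric.isOpen_ball.preimage ha.continuous
  have hψ : ContDiffOn ℝ ∞ (α ∘ a) O₁ := hα.comp ha.contDiffOn fun q hq => hq
  have ha0 : a 0 = (x₀, 0) := Prod.ext ((congrArg (x₀ + ·) A.map_zero).trans (add_zero x₀)) rfl
  have h0₁ : (0 : F × ℝ) ∈ O₁ := by
    simpa only [O₁, mem_preimage, ha0] using Metric.mem_ball_self hr
  have hstart : ∀ y : F, (y, (0 : ℝ)) ∈ O₁ → α (a (y, 0)) = x₀ + A (y, 0) :=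
    fun y hy => (hflow _ _ hy).1
  have hψ0 : (α ∘ a) 0 = x₀ := (congrArg α ha0).trans (hflow _ _ (Metric.mem_ball_self hr)).1
  have hdiff : ∀ q ∈ O₁, HasFDerivAt (α ∘ a) (fderiv ℝ (α ∘ a) q) q := fun q hq =>
    ((hψ.contDiffAt (hO₁.mem_nhds hq)).differentiableAt (by simp)).hasFDerivAt
  let O : Set (F × ℝ) := O₁ ∩ (α ∘ a) ⁻¹' Metric.ball x₀ ρ
  have h0 : (0 : F × ℝ) ∈ O :=
    ⟨h0₁, by simpa only [mem_preimage, hψ0] using Metric.mem_ball_self hρ⟩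
  have htime : ∀ q ∈ O, fderiv ℝ (α ∘ a) q (0, 1) = v ((α ∘ a) q) := by
    intro q hq
    have hline := (hdiff q hq.1).comp_hasDerivAt q.2
      ((hasDerivAt_const q.2 q.1).prodMk (hasDerivAt_id q.2))
    rw [← hwv hq.2]
    exact hline.unique (hflow _ _ hq.1).2
  refine ⟨α ∘ a, O, hψ.continuousOn.isOpen_inter_preimage hO₁ Metric.isOpen_ball, h0,
    hψ.mono inter_subset_left, fun q hq => hρU hq.2, hψ0, htime,
    (hdiff 0 h0₁).congr_fderiv (ContinuousLinearMap.prod_ext ?_ ?_)⟩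
  · have hspace := HasFDerivAt.comp (f := fun y : F => (y, (0 : ℝ))) 0 (hdiff 0 h0₁)
      (hasFDerivAt_prodMk_left 0 0)
    refine hspace.unique (((A.comp (.inl ℝ F ℝ)).hasFDerivAt.const_add x₀).congr_of_eventuallyEq ?_)
    filter_upwards [(hO₁.preimage (Continuous.prodMk_left (0 : ℝ))).mem_nhds h0₁] with y hy
    exact hstart y hy
  · ext
    exact (htime 0 h0).trans ((congrArg v hψ0).trans hA.symm)

/-- The straightening is the inverse of the flow-out of the hyperplane `x₀ + A (F × 0)`. -/
theorem exists_straightens {E F : Type u} [NormedAddCommGroup E] [NormedSpace ℝ E]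
    [NormedAddCommGroup F] [NormedSpace ℝ F] [FiniteDimensional ℝ E] {U : Set E} (hU : IsOpen U)
    {v : E → E} (hv : ContDiffOn ℝ ∞ v U) {x₀ : E} (hx₀ : x₀ ∈ U) (A : (F × ℝ) ≃L[ℝ] E)
    (hA : A (0, 1) = v x₀) :
    ∃ e : OpenPartialHomeomorph E (F × ℝ), x₀ ∈ e.source ∧ e.source ⊆ U ∧ Straightens v e ∧
      HasFDerivAt e (A.symm : E →L[ℝ] F × ℝ) x₀ := by
  have : FiniteDimensional ℝ (F × ℝ) := A.symm.toLinearEquiv.finiteDimensional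
  have : CompleteSpace (F × ℝ) := FiniteDimensional.complete ℝ _
  obtain ⟨ψ, O, hO, h0, hψ, hψU, hψ0, hψ_time, hψA⟩ :=
    exists_flowOut hU hv hx₀ (A : (F × ℝ) →L[ℝ] E) hA
  obtain ⟨e, h0e, heO, he, he_symm⟩ :=
    exists_openPartialHomeomorph_of_contDiffOn (by simp) hO hψ h0 hψA
  subst he
  have hdiff : ∀ q ∈ e.source, DifferentiableAt ℝ e q ∧ DifferentiableAt ℝ e.symm (e q) :=
    fun q hq => ⟨(hψ.contDiffAt (hO.mem_nhds (heO hq))).differentiableAt (by simp),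
      (he_symm.contDiffAt (e.open_target.mem_nhds (e.map_source hq))).differentiableAt (by simp)⟩
  refine ⟨e.symm, hψ0 ▸ e.map_source h0e, ?_, ⟨he_symm, hψ.mono heO, ?_⟩, ?_⟩
  · intro z hz
    exact e.right_inv hz ▸ hψU (heO (e.map_target hz))
  · intro z hz
    obtain ⟨q, hq, rfl⟩ : ∃ q ∈ e.source, e q = z := ⟨e.symm z, e.map_target hz, e.right_inv hz⟩
    rw [← hψ_time q (heO hq)]
    exact fderiv_symm_fderiv_apply hq (hdiff q hq).1 (hdiff q hq).2 _
  · exact hψ0 ▸ e.hasFDerivAt_symm (e.map_source h0e) ((e.left_inv h0e).symm ▸ hψA)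

theorem exists_target_eq_ball {X Y : Type*} [TopologicalSpace X] [PseudoMetricSpace Y]
    (e : OpenPartialHomeomorph X Y) {x : X} (hx : x ∈ e.source) :
    ∃ e' : OpenPartialHomeomorph X Y, x ∈ e'.source ∧ e'.source ⊆ e.source ∧ e'.target ⊆ e.target ∧
      (e' : X → Y) = e ∧ (e'.symm : Y → X) = e.symm ∧ ∃ r, e'.target = Metric.ball (e x) r := by
  obtain ⟨r, hr, hsub⟩ := Metric.isOpen_iff.1 e.open_target (e x) (e.map_source hx)
  exact ⟨(e.symm.restrOpen (Metric.ball (e x) r) Metric.isOpen_ball).symm,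
    ⟨hx, Metric.mem_ball_self hr⟩, fun z hz => hz.1, fun z hz => hz.1, rfl, rfl, r,
    inter_eq_right.2 hsub⟩

/-- The straightening coordinates of `exists_straightens`, with the last one replaced by `τ`. -/
theorem exists_straightens_snd_eq {E F : Type u} [NormedAddCommGroup E] [NormedSpace ℝ E]
    [NormedAddCommGroup F] [NormedSpace ℝ F] [FiniteDimensional ℝ E] [FiniteDimensional ℝ F]
    (hEF : Module.finrank ℝ F + 1 = Module.finrank ℝ E) {U : Set E} (hU : IsOpen U)
    {v : E → E} (hv : ContDiffOn ℝ ∞ v U) {τ : E → ℝ} (hτ : ContDiffOn ℝ ∞ τ U)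
    (hvτ : ∀ z ∈ U, fderiv ℝ τ z (v z) = 1) {x₀ : E} (hx₀ : x₀ ∈ U) :
    ∃ e : OpenPartialHomeomorph E (F × ℝ), x₀ ∈ e.source ∧ e.source ⊆ U ∧ Straightens v e ∧
      ∀ z ∈ e.source, (e z).2 = τ z := by
  have : CompleteSpace E := FiniteDimensional.complete ℝ E
  have hτ' : ∀ z ∈ U, HasFDerivAt τ (fderiv ℝ τ z) z := fun z hz =>
    ((hτ.contDiffAt (hU.mem_nhds hz)).differentiableAt (by simp)).hasFDerivAt
  obtain ⟨A, hAτ, hAv⟩ := exists_prod_equiv_of_apply_eq_one (F := F) hEF (fderiv ℝ τ x₀)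
    (hvτ x₀ hx₀)
  obtain ⟨e, hxe, heU, he, heA⟩ := exists_straightens hU hv hx₀ A hAv
  have hG : ContDiffOn ℝ ∞ (fun z => ((e z).1, τ z)) e.source :=
    he.contDiffOn.fst.prodMk (hτ.mono heU)
  have hGA : HasFDerivAt (fun z => ((e z).1, τ z)) (A.symm : E →L[ℝ] F × ℝ) x₀ := by
    refine (heA.fst.prodMk (hτ' x₀ hx₀)).congr_fderiv (ContinuousLinearMap.ext fun u => ?_)
    refine Prod.ext rfl ?_
    simpa using hAτ (A.symm u)
  obtain ⟨e', hxe', he'e, he', he'_symm⟩ :=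
    exists_openPartialHomeomorph_of_contDiffOn (by simp) e.open_source hG hxe hGA
  refine ⟨e', hxe', he'e.trans heU, ⟨he' ▸ hG.mono he'e, he'_symm, fun z hz => ?_⟩,
    fun z _ => congrArg Prod.snd (congrFun he' z)⟩
  have hez : HasFDerivAt e (fderiv ℝ e z) z := ((he.contDiffOn.contDiffAt
    (e.open_source.mem_nhds (he'e hz))).differentiableAt (by simp)).hasFDerivAt
  rw [he', (hez.fst.prodMk (hτ' z (heU (he'e hz)))).fderiv]
  refine Prod.ext ?_ (hvτ z (heU (he'e hz)))
  exact (congrArg Prod.fst (he.fderiv_apply z (he'e hz)) :)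

end FlowBox

section ChartFields

variable {E H N F : Type*} [NormedAddCommGroup E] [NormedSpace ℝ E] [TopologicalSpace H]
  {I : ModelWithCorners ℝ E H} [TopologicalSpace N] [ChartedSpace H N] [NormedAddCommGroup F]
  [NormedSpace ℝ F]

theorem isInvertible_mfderiv_extChartAt_symm [I.Boundaryless] [IsManifold I 1 N] {p : N} {y : E}
    (hy : y ∈ (extChartAt I p).target) :
    (mfderiv 𝓘(ℝ, E) I (extChartAt I p).symm y).IsInvertible := by
  have h := isInvertible_mfderivWithin_extChartAt_symm hy
  rwa [I.range_eq_univ, mfderivWithin_univ] at h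

theorem contMDiffAt_extChartAt_symm [I.Boundaryless] [IsManifold I ∞ N] {p : N} {y : E}
    (hy : y ∈ (extChartAt I p).target) : ContMDiffAt 𝓘(ℝ, E) I ∞ (extChartAt I p).symm y :=
  (contMDiffOn_extChartAt_symm p).contMDiffAt ((isOpen_extChartAt_target p).mem_nhds hy)

theorem contDiffAt_mpullback_extChartAt_symm [CompleteSpace E] [I.Boundaryless] [IsManifold I ∞ N]
    {X : ∀ q : N, TangentSpace I q} {p : N} {y : E} (hy : y ∈ (extChartAt I p).target)
    (hX : ContMDiffAt I I.tangent ∞ (fun q => (⟨q, X q⟩ : TangentBundle I N))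
      ((extChartAt I p).symm y)) :
    ContDiffAt ℝ ∞ (VectorField.mpullback 𝓘(ℝ, E) I (extChartAt I p).symm X) y := by
  have : IsManifold I 1 N := .of_le (n := ∞) (by simp)
  exact contMDiffAt_vectorSpace_iff_contDiffAt.1 (hX.mpullback_vectorField_preimage
    (contMDiffAt_extChartAt_symm hy) (isInvertible_mfderiv_extChartAt_symm hy) (by simp))

theorem mfderiv_extChartAt_symm_mpullback [I.Boundaryless] [IsManifold I 1 N]
    (X : ∀ q : N, TangentSpace I q) {p : N} {y : E} (hy : y ∈ (extChartAt I p).target) :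
    mfderiv 𝓘(ℝ, E) I (extChartAt I p).symm y
        (VectorField.mpullback 𝓘(ℝ, E) I (extChartAt I p).symm X y)
      = X ((extChartAt I p).symm y) :=
  (isInvertible_mfderiv_extChartAt_symm hy).self_apply_inverse _

theorem fderiv_comp_extChartAt_symm [I.Boundaryless] [IsManifold I ∞ N]
    (X : ∀ q : N, TangentSpace I q) {p : N} {y : E} (hy : y ∈ (extChartAt I p).target) {f : N → F}
    (hf : MDifferentiableAt I 𝓘(ℝ, F) f ((extChartAt I p).symm y)) :
    fderiv ℝ (f ∘ (extChartAt I p).symm) y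
        (VectorField.mpullback 𝓘(ℝ, E) I (extChartAt I p).symm X y)
      = mvfderiv I f ((extChartAt I p).symm y) (X ((extChartAt I p).symm y)) := by
  have : IsManifold I 1 N := .of_le (n := ∞) (by simp)
  have hcomp := mfderiv_comp y hf ((contMDiffAt_extChartAt_symm hy).mdifferentiableAt (by simp))
  rw [mfderiv_eq_fderiv] at hcomp
  rw [hcomp, ← mfderiv_extChartAt_symm_mpullback X hy]
  rfl

end ChartFields

section IntegralCurves

variable {E H N F : Type*} [NormedAddCommGroup E] [NormedSpace ℝ E] [TopologicalSpace H]
  {I : ModelWithCorners ℝ E H} [TopologicalSpace N] [ChartedSpace H N] [NormedAddCommGroup F]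
  [NormedSpace ℝ F] {f : N → F} {γ : ℝ → N}

theorem hasDerivAt_comp_of_hasMFDerivAt {s : ℝ} {v : TangentSpace I (γ s)}
    (hf : MDifferentiableAt I 𝓘(ℝ, F) f (γ s))
    (hγ : HasMFDerivAt 𝓘(ℝ, ℝ) I γ s ((1 : ℝ →L[ℝ] ℝ).smulRight v)) :
    HasDerivAt (f ∘ γ) (mvfderiv I f (γ s) v) s := by
  let A : ℝ →L[ℝ] F := (mfderiv I 𝓘(ℝ, F) f (γ s)).comp ((1 : ℝ →L[ℝ] ℝ).smulRight v)
  have hA : HasFDerivAt (f ∘ γ) A s := (hf.hasMFDerivAt.comp s hγ).hasFDerivAt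
  exact hA.hasDerivAt.congr_deriv (congrArg (mvfderiv I f (γ s)) (one_smul ℝ v))

theorem apply_eq_add_smul_of_isMIntegralCurveOn {X : ∀ p : N, TangentSpace I p} {J : Set ℝ}
    (hJ : IsOpen J) (hJ' : J.OrdConnected) (hγ : IsMIntegralCurveOn γ X J)
    (hf : ∀ s ∈ J, MDifferentiableAt I 𝓘(ℝ, F) f (γ s)) {c : F}
    (hc : ∀ s ∈ J, mvfderiv I f (γ s) (X (γ s)) = c) {s t : ℝ} (hs : s ∈ J) (ht : t ∈ J) :
    f (γ t) = f (γ s) + (t - s) • c := by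
  have hder : ∀ r ∈ J, HasDerivAt (fun r => f (γ r) - r • c) 0 r := fun r hr => by
    have h := hasDerivAt_comp_of_hasMFDerivAt (hf r hr) ((hγ r hr).hasMFDerivAt (hJ.mem_nhds hr))
    rw [hc r hr] at h
    exact (h.sub ((hasDerivAt_id r).smul_const c)).congr_deriv (by simp)
  have hconst := hJ.is_const_of_deriv_eq_zero hJ'.isPreconnected
    (fun r hr => (hder r hr).differentiableAt.differentiableWithinAt)
    (fun r hr => (hder r hr).deriv) ht hs
  rw [sub_smul, ← sub_eq_zero]
  rw [← sub_eq_zero] at hconst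
  rw [← hconst]
  abel

end IntegralCurves

namespace PreSpacetime

variable {n : ℕ} {𝓜 : Type u} [TopologicalSpace 𝓜]
  [ChartedSpace (EuclideanSpace ℝ (Fin (n + 1))) 𝓜] [IsManifold (𝓡 (n + 1)) ∞ 𝓜] {I : Set ℝ}

section FlowBoxes

variable (S : PreSpacetime n 𝓜 I)

/-- A flow box: smooth coordinates `(y, t)` on an open subset of `𝓜`, onto a ball, in which `t` is
the time function and `∂_t` is the last coordinate field. -/
structure IsFlowBox (F : OpenPartialHomeomorph 𝓜 (EuclideanSpace ℝ (Fin n) × ℝ)) : Prop where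
  contMDiffOn : ContMDiffOn (𝓡 (n + 1)) 𝓘(ℝ, EuclideanSpace ℝ (Fin n) × ℝ) ∞ F F.source
  contMDiffOn_symm : ContMDiffOn 𝓘(ℝ, EuclideanSpace ℝ (Fin n) × ℝ) (𝓡 (n + 1)) ∞ F.symm F.target
  snd_eq : ∀ z ∈ F.source, (F z).2 = S.time z
  mvfderiv_dt : ∀ z ∈ F.source, mvfderiv (𝓡 (n + 1)) F z (S.dt z) = (0, 1)
  target_eq : ∃ c r, F.target = Metric.ball c r

theorem contMDiff_dt : ContMDiff (𝓡 (n + 1)) (𝓡 (n + 1)).tangent ∞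
    (fun p => (⟨p, S.dt p⟩ : TangentBundle (𝓡 (n + 1)) 𝓜)) :=
  contMDiffOn_univ.1 S.dt_smooth

theorem exists_straightens_extChartAt (x : 𝓜) :
    ∃ e : OpenPartialHomeomorph (EuclideanSpace ℝ (Fin (n + 1))) (EuclideanSpace ℝ (Fin n) × ℝ),
      extChartAt (𝓡 (n + 1)) x x ∈ e.source ∧ e.source ⊆ (extChartAt (𝓡 (n + 1)) x).target ∧
      Straightens (VectorField.mpullback (𝓡 (n + 1)) (𝓡 (n + 1))
        (extChartAt (𝓡 (n + 1)) x).symm S.dt) e ∧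
      ∀ y ∈ e.source, (e y).2 = S.time ((extChartAt (𝓡 (n + 1)) x).symm y) :=
  exists_straightens_snd_eq (by simp) (isOpen_extChartAt_target x)
    (fun _ hy => (contDiffAt_mpullback_extChartAt_symm hy (S.contMDiff_dt _)).contDiffWithinAt)
    (S.time_smooth.comp_contMDiffOn (contMDiffOn_extChartAt_symm x)).contDiffOn
    (fun _ hy => (fderiv_comp_extChartAt_symm S.dt hy
      (S.time_smooth.mdifferentiableAt (by simp))).trans (S.dt_time _)) (mem_extChartAt_target x)

theorem exists_isFlowBox (x : 𝓜) : ∃ F, x ∈ F.source ∧ S.IsFlowBox F := by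
  obtain ⟨e, hxe, heU, he, heτ⟩ := S.exists_straightens_extChartAt x
  set c := extChartAt (𝓡 (n + 1)) x
  obtain ⟨F, hxF, hF_source, hF_target, hF, hF_symm, hFr⟩ := exists_target_eq_ball
    ((chartAt (EuclideanSpace ℝ (Fin (n + 1))) x).trans e) (x := x) ⟨mem_chart_source _ x, hxe⟩
  have hsource : ∀ z ∈ F.source, z ∈ c.source ∧ c z ∈ e.source := fun z hz =>
    ⟨(extChartAt_source (𝓡 (n + 1)) x).symm ▸ (hF_source hz).1, (hF_source hz).2⟩
  have hFc : ContMDiffOn (𝓡 (n + 1)) 𝓘(ℝ, EuclideanSpace ℝ (Fin n) × ℝ) ∞ F F.source := by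
    rw [hF]
    exact he.contDiffOn.contMDiffOn.comp
      (contMDiffOn_extChartAt.mono fun z hz => (hF_source hz).1) fun z hz => (hsource z hz).2
  refine ⟨F, hxF, hFc, ?_, fun z hz => ?_, fun z hz => ?_, _, hFr⟩
  · rw [hF_symm]
    exact (contMDiffOn_extChartAt_symm x).comp
      (he.contDiffOn_symm.contMDiffOn.mono fun q hq => (hF_target hq).1)
      fun q hq => heU (e.map_target (hF_target hq).1)
  · rw [hF]
    exact (heτ _ (hsource z hz).2).trans (congrArg S.time (c.left_inv (hsource z hz).1))
  · obtain ⟨y, hye, rfl⟩ : ∃ y ∈ e.source, c.symm y = z :=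
      ⟨c z, (hsource z hz).2, c.left_inv (hsource z hz).1⟩
    have hFe : F ∘ c.symm =ᶠ[𝓝 y] e := by
      filter_upwards [(isOpen_extChartAt_target x).mem_nhds (heU hye)] with w hw
      exact (congrFun hF _).trans (congrArg e (c.right_inv hw))
    rw [← he.fderiv_apply y hye, ← hFe.fderiv_eq]
    exact (fderiv_comp_extChartAt_symm S.dt (heU hye) ((hFc.contMDiffAt
      (F.open_source.mem_nhds hz)).mdifferentiableAt (by simp))).symm

end FlowBoxes

end PreSpacetime

theorem exists_Ioo_subset_of_isOpen_ordConnected {α : Type*} [LinearOrder α] [TopologicalSpace α]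
    [OrderTopology α] [NoMinOrder α] [NoMaxOrder α] {J : Set α} (hJ : IsOpen J)
    (hJ' : J.OrdConnected) {a b : α} (ha : a ∈ J) (hb : b ∈ J) :
    ∃ l u, a ∈ Ioo l u ∧ b ∈ Ioo l u ∧ Ioo l u ⊆ J := by
  wlog hab : a ≤ b generalizing a b
  · obtain ⟨l, u, hbI, haI, hI⟩ := this hb ha (le_of_not_ge hab)
    exact ⟨l, u, haI, hbI, hI⟩
  obtain ⟨l, u', ha', hlJ⟩ := mem_nhds_iff_exists_Ioo_subset.1 (hJ.mem_nhds ha)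
  obtain ⟨l', u, hb', huJ⟩ := mem_nhds_iff_exists_Ioo_subset.1 (hJ.mem_nhds hb)
  refine ⟨l, u, ⟨ha'.1, hab.trans_lt hb'.2⟩, ⟨ha'.1.trans_le hab, hb'.2⟩, fun s hs => ?_⟩
  rcases lt_or_ge s a with hsa | has
  · exact hlJ ⟨hs.1, hsa.trans ha'.2⟩
  rcases le_or_gt s b with hsb | hbs
  · exact hJ'.out ha hb ⟨has, hsb⟩
  · exact huJ ⟨hb'.1.trans hbs, hs.2⟩

namespace PreSpacetime

variable {n : ℕ} {𝓜 : Type u} [TopologicalSpace 𝓜]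
  [ChartedSpace (EuclideanSpace ℝ (Fin (n + 1))) 𝓜] [IsManifold (𝓡 (n + 1)) ∞ 𝓜] {I : Set ℝ}

section Worldlines

variable (S : PreSpacetime n 𝓜 I)

theorem time_mem (x : 𝓜) : S.time x ∈ I := S.time_range.subset (mem_range_self x)

variable {S} {x y z : 𝓜}

theorem time_eq_of_isMIntegralCurveOn {J : Set ℝ} (hJ : IsOpen J) (hJ' : J.OrdConnected)
    {γ : ℝ → 𝓜} (hγ : IsMIntegralCurveOn γ S.dt J) {s t : ℝ} (hs : s ∈ J)
    (h : S.time (γ s) = s) (ht : t ∈ J) : S.time (γ t) = t := by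
  have := apply_eq_add_smul_of_isMIntegralCurveOn hJ hJ' hγ
    (fun r _ => S.time_smooth.mdifferentiableAt (by simp)) (fun r _ => S.dt_time (γ r)) hs ht
  simpa only [h, smul_eq_mul, mul_one, add_sub_cancel] using this

theorem WorldlineAt.time_eq {t : ℝ} (h : S.WorldlineAt x t y) : S.time y = t := by
  obtain ⟨J, γ, hJ, hJ', hx, ht, hγ, hγx, rfl⟩ := h
  exact time_eq_of_isMIntegralCurveOn hJ hJ' hγ hx (congrArg S.time hγx) ht

variable (S) in
/-- Two points lie on a common worldline. -/
def SameWorldline (x y : 𝓜) : Prop := ∃ t, S.WorldlineAt x t y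

theorem sameWorldline_iff : S.SameWorldline x y ↔ ∃ (l u : ℝ) (γ : ℝ → 𝓜), S.time x ∈ Ioo l u ∧
    S.time y ∈ Ioo l u ∧ IsMIntegralCurveOn γ S.dt (Ioo l u) ∧ γ (S.time x) = x ∧
    γ (S.time y) = y := by
  constructor
  · rintro ⟨t, h⟩
    obtain rfl := h.time_eq
    obtain ⟨J, γ, hJ, hJ', hx, hy, hγ, hγx, hγy⟩ := h
    obtain ⟨l, u, hxI, hyI, hIJ⟩ := exists_Ioo_subset_of_isOpen_ordConnected hJ hJ' hx hy
    exact ⟨l, u, γ, hxI, hyI, hγ.mono hIJ, hγx, hγy⟩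
  · rintro ⟨l, u, γ, hx, hy, hγ, hγx, hγy⟩
    exact ⟨S.time y, Ioo l u, γ, isOpen_Ioo, ordConnected_Ioo, hx, hy, hγ, hγx, hγy⟩

theorem SameWorldline.symm (h : S.SameWorldline x y) : S.SameWorldline y x := by
  obtain ⟨l, u, γ, hx, hy, hγ, hγx, hγy⟩ := sameWorldline_iff.1 h
  exact sameWorldline_iff.2 ⟨l, u, γ, hy, hx, hγ, hγy, hγx⟩

theorem SameWorldline.eq_of_time_eq (h : S.SameWorldline x y) (ht : S.time x = S.time y) :
    x = y := by
  obtain ⟨l, u, γ, -, -, -, hγx, hγy⟩ := sameWorldline_iff.1 h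
  rw [← hγx, ht, hγy]

theorem SameWorldline.trans [T2Space 𝓜] (h : S.SameWorldline x y) (h' : S.SameWorldline y z) :
    S.SameWorldline x z := by
  classical
  obtain ⟨l, u, γ, hx, hy, hγ, hγx, hγy⟩ := sameWorldline_iff.1 h
  obtain ⟨l', u', γ', hy', hz', hγ', hγy', hγz'⟩ := sameWorldline_iff.1 h'
  have hv : ContMDiff (𝓡 (n + 1)) (𝓡 (n + 1)).tangent 1
      (fun p => (⟨p, S.dt p⟩ : TangentBundle (𝓡 (n + 1)) 𝓜)) := S.contMDiff_dt.of_le (by simp)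
  have heq : γ (S.time y) = γ' (S.time y) := hγy.trans hγy'.symm
  refine ⟨S.time z, Ioo l u ∪ Ioo l' u', piecewise (Ioo l u) γ γ', isOpen_Ioo.union isOpen_Ioo,
    (isPreconnected_Ioo.union _ hy hy' isPreconnected_Ioo).ordConnected, Or.inl hx, Or.inr hz',
    isMIntegralCurveOn_piecewise hv hγ hγ' ⟨hy, hy'⟩ heq, ?_, ?_⟩
  · rw [piecewise_eq_of_mem _ _ _ hx, hγx]
  · rw [eqOn_piecewise_of_isMIntegralCurveOn_Ioo hv hγ hγ' ⟨hy, hy'⟩ heq hz', hγz']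

theorem mem_worldlineDomain_of_le {s t : ℝ} (ht : t ∈ S.worldlineDomain x)
    (hs : S.time x ≤ s) (hst : s ≤ t) : s ∈ S.worldlineDomain x := by
  obtain ⟨y, J, γ, hJ, hJ', hx, ht', hγ, hγx, -⟩ := ht
  exact ⟨γ s, J, γ, hJ, hJ', hx, hJ'.out hx ht' ⟨hs, hst⟩, hγ, hγx, rfl⟩

end Worldlines

namespace IsFlowBox

variable {S : PreSpacetime n 𝓜 I} {F : OpenPartialHomeomorph 𝓜 (EuclideanSpace ℝ (Fin n) × ℝ)}

theorem time_symm (hF : S.IsFlowBox F) {q : EuclideanSpace ℝ (Fin n) × ℝ} (hq : q ∈ F.target) :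
    S.time (F.symm q) = q.2 := by
  rw [← hF.snd_eq _ (F.map_target hq), F.right_inv hq]

theorem mdifferentiableAt (hF : S.IsFlowBox F) {z : 𝓜} (hz : z ∈ F.source) :
    MDifferentiableAt (𝓡 (n + 1)) 𝓘(ℝ, EuclideanSpace ℝ (Fin n) × ℝ) F z :=
  (hF.contMDiffOn.contMDiffAt (F.open_source.mem_nhds hz)).mdifferentiableAt (by simp)

theorem mdifferentiable (hF : S.IsFlowBox F) :
    F.MDifferentiable (𝓡 (n + 1)) 𝓘(ℝ, EuclideanSpace ℝ (Fin n) × ℝ) :=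
  ⟨hF.contMDiffOn.mdifferentiableOn (by simp), hF.contMDiffOn_symm.mdifferentiableOn (by simp)⟩

theorem mfderiv_symm_zero_one (hF : S.IsFlowBox F) {q : EuclideanSpace ℝ (Fin n) × ℝ}
    (hq : q ∈ F.target) :
    mfderiv 𝓘(ℝ, EuclideanSpace ℝ (Fin n) × ℝ) (𝓡 (n + 1)) F.symm q
      ((0, 1) : EuclideanSpace ℝ (Fin n) × ℝ) = S.dt (F.symm q) := by
  obtain ⟨z, hz, rfl⟩ : ∃ z ∈ F.source, F z = q := ⟨F.symm q, F.map_target hq, F.right_inv hq⟩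
  have h := hF.mdifferentiable.symm_comp_deriv hz
  rw [F.left_inv hz, ← hF.mvfderiv_dt z hz]
  exact DFunLike.congr_fun h (S.dt z)

theorem hasMFDerivAt_symm (hF : S.IsFlowBox F) {q : EuclideanSpace ℝ (Fin n) × ℝ}
    (hq : q ∈ F.target) : HasMFDerivAt 𝓘(ℝ, ℝ) (𝓡 (n + 1)) (fun s => F.symm (q.1, s)) q.2
      ((1 : ℝ →L[ℝ] ℝ).smulRight (S.dt (F.symm q))) := by
  have hline : HasMFDerivAt 𝓘(ℝ, ℝ) 𝓘(ℝ, EuclideanSpace ℝ (Fin n) × ℝ) (fun s => (q.1, s)) q.2 _ :=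
    (hasFDerivAt_prodMk_right q.1 q.2).hasMFDerivAt
  have hsymm := (hF.mdifferentiable.mdifferentiableAt_symm hq).hasMFDerivAt
  refine (HasMFDerivAt.comp (f := fun s => (q.1, s)) q.2 hsymm hline).congr_mfderiv ?_
  ext1
  exact (hF.mfderiv_symm_zero_one hq).trans (one_smul ℝ _).symm

theorem target_eq_prod (hF : S.IsFlowBox F) :
    ∃ (B : Set (EuclideanSpace ℝ (Fin n))) (c r : ℝ), F.target = B ×ˢ Metric.ball c r := by
  obtain ⟨c, r, h⟩ := hF.target_eq
  exact ⟨Metric.ball c.1 r, c.2, r, h.trans (ball_prod_same c.1 c.2 r).symm⟩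

theorem sameWorldline_symm (hF : S.IsFlowBox F) {b : EuclideanSpace ℝ (Fin n)} {t t' : ℝ}
    (h : (b, t) ∈ F.target) (h' : (b, t') ∈ F.target) :
    S.SameWorldline (F.symm (b, t)) (F.symm (b, t')) := by
  obtain ⟨B, c, r, hBr⟩ := hF.target_eq_prod
  rw [hBr] at h h'
  refine ⟨t', Metric.ball c r, fun s => F.symm (b, s), Metric.isOpen_ball,
    Real.ball_eq_Ioo c r ▸ ordConnected_Ioo, ?_, h'.2, fun s hs => ?_, ?_, rfl⟩
  · rw [hF.time_symm (hBr ▸ h)]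
    exact h.2
  · exact (hF.hasMFDerivAt_symm (q := (b, s)) (hBr ▸ ⟨h.1, hs⟩)).hasMFDerivWithinAt
  · rw [hF.time_symm (hBr ▸ h)]

theorem fst_eq_of_isMIntegralCurveOn (hF : S.IsFlowBox F) {J : Set ℝ} (hJ : IsOpen J)
    (hJ' : J.OrdConnected) {γ : ℝ → 𝓜} (hγ : IsMIntegralCurveOn γ S.dt J)
    (hγF : MapsTo γ J F.source)
    {s t : ℝ} (hs : s ∈ J) (ht : t ∈ J) : (F (γ s)).1 = (F (γ t)).1 := by
  have h := apply_eq_add_smul_of_isMIntegralCurveOn hJ hJ' hγ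
    (fun r hr => hF.mdifferentiableAt (hγF hr)) (fun r hr => hF.mvfderiv_dt _ (hγF hr)) ht hs
  simp [h]

/-- The time of the centre of a flow box. -/
def centerTime (hF : S.IsFlowBox F) : ℝ := hF.target_eq.choose.2

theorem prodMk_centerTime_mem (hF : S.IsFlowBox F) {b : EuclideanSpace ℝ (Fin n)}
    (hb : b ∈ Prod.fst '' F.target) : (b, hF.centerTime) ∈ F.target := by
  obtain ⟨⟨b', t⟩, hq, rfl⟩ := hb
  obtain ⟨r, hr⟩ := hF.target_eq.choose_spec
  rw [hr, ← ball_prod_same] at hq ⊢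
  exact ⟨hq.1, Metric.mem_ball_self (Metric.pos_of_mem_ball hq.1)⟩

theorem mem_target_of_mem (hF : S.IsFlowBox F) {q q' : EuclideanSpace ℝ (Fin n) × ℝ}
    (hq : q ∈ F.target) (hq' : q' ∈ F.target) : (q.1, q'.2) ∈ F.target := by
  obtain ⟨B, c, r, h⟩ := hF.target_eq_prod
  rw [h] at hq hq' ⊢
  exact ⟨hq.1, hq'.2⟩

end IsFlowBox

theorem SameWorldline.refl {S : PreSpacetime n 𝓜 I} (x : 𝓜) : S.SameWorldline x x := by
  obtain ⟨F, hx, hF⟩ := S.exists_isFlowBox x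
  have h := F.map_source hx
  exact F.left_inv hx ▸ hF.sameWorldline_symm (b := (F x).1) h h

/-! ### The space of worldlines -/

section FlowBoxes

variable (S : PreSpacetime n 𝓜 I)

/-- A flow box around a point. -/
def box (x : 𝓜) : OpenPartialHomeomorph 𝓜 (EuclideanSpace ℝ (Fin n) × ℝ) :=
  (S.exists_isFlowBox x).choose

theorem mem_box_source (x : 𝓜) : x ∈ (S.box x).source := (S.exists_isFlowBox x).choose_spec.1

theorem isFlowBox_box (x : 𝓜) : S.IsFlowBox (S.box x) := (S.exists_isFlowBox x).choose_spec.2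

/-- There is a smooth germ at `y`, mapping `y` to `x`, that moves points along their worldlines. -/
def Holonomy (x y : 𝓜) : Prop :=
  ∃ θ : 𝓜 → 𝓜, ContMDiffAt (𝓡 (n + 1)) (𝓡 (n + 1)) ∞ θ y ∧ θ y = x ∧
    ∀ᶠ z in 𝓝 y, S.SameWorldline z (θ z)

variable {S} {F : OpenPartialHomeomorph 𝓜 (EuclideanSpace ℝ (Fin n) × ℝ)}

theorem IsFlowBox.contMDiffAt_fst (hF : S.IsFlowBox F) {z : 𝓜} (hz : z ∈ F.source) :
    ContMDiffAt (𝓡 (n + 1)) (𝓡 n) ∞ (fun z => (F z).1) z :=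
  contDiff_fst.contMDiff.contMDiffAt.comp z
    (hF.contMDiffOn.contMDiffAt (F.open_source.mem_nhds hz))

theorem IsFlowBox.contMDiffAt_symm_prodMk (hF : S.IsFlowBox F)
    {q : EuclideanSpace ℝ (Fin n) × ℝ} (hq : q ∈ F.target) :
    ContMDiffAt (𝓡 n) (𝓡 (n + 1)) ∞ (fun b => F.symm (b, q.2)) q.1 :=
  (hF.contMDiffOn_symm.contMDiffAt (F.open_target.mem_nhds hq)).comp q.1
    ((contDiff_prodMk_left q.2).contMDiff.contMDiffAt)

theorem IsFlowBox.holonomy_of_fst_eq (hF : S.IsFlowBox F) {x y : 𝓜} (hx : x ∈ F.source)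
    (hy : y ∈ F.source) (hxy : (F x).1 = (F y).1) : S.Holonomy x y := by
  have htarget {z : 𝓜} (hz : z ∈ F.source) : ((F z).1, (F x).2) ∈ F.target :=
    hF.mem_target_of_mem (F.map_source hz) (F.map_source hx)
  refine ⟨fun z => F.symm ((F z).1, (F x).2), ?_, ?_, ?_⟩
  · have hshift : ContMDiffAt (𝓡 (n + 1)) 𝓘(ℝ, EuclideanSpace ℝ (Fin n) × ℝ) ∞
        (fun z => ((F z).1, (F x).2)) y := (hF.contMDiffAt_fst hy).prodMk_space contMDiffAt_const
    exact ContMDiffAt.comp y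
      (hF.contMDiffOn_symm.contMDiffAt (F.open_target.mem_nhds (htarget hy))) hshift
  · simp only [← hxy, Prod.mk.eta, F.left_inv hx]
  · filter_upwards [F.open_source.mem_nhds hy] with z hz
    have h := hF.sameWorldline_symm (b := (F z).1) (t := (F z).2) (F.map_source hz) (htarget hz)
    rwa [Prod.mk.eta, F.left_inv hz] at h

theorem eventually_holonomy_of_isMIntegralCurveOn {J : Set ℝ} (hJ : IsOpen J) {γ : ℝ → 𝓜}
    (hγ : IsMIntegralCurveOn γ S.dt J) {s : ℝ} (hs : s ∈ J) :
    ∀ᶠ s' in 𝓝 s, S.Holonomy (γ s) (γ s') ∧ S.Holonomy (γ s') (γ s) := by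
  obtain ⟨F, hsF, hF⟩ := S.exists_isFlowBox (γ s)
  have hcont : ContinuousAt γ s := (hγ s hs).continuousWithinAt.continuousAt (hJ.mem_nhds hs)
  obtain ⟨ε, hε, hball⟩ := Metric.mem_nhds_iff.1 (Filter.inter_mem (hJ.mem_nhds hs)
    (hcont.preimage_mem_nhds (F.open_source.mem_nhds hsF)))
  filter_upwards [Metric.ball_mem_nhds s hε] with s' hs'
  have hfst : (F (γ s)).1 = (F (γ s')).1 :=
    hF.fst_eq_of_isMIntegralCurveOn Metric.isOpen_ball (Real.ball_eq_Ioo s ε ▸ ordConnected_Ioo)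
      (hγ.mono fun r hr => (hball hr).1) (fun r hr => (hball hr).2) (Metric.mem_ball_self hε) hs'
  exact ⟨hF.holonomy_of_fst_eq hsF (hball hs').2 hfst,
    hF.holonomy_of_fst_eq (hball hs').2 hsF hfst.symm⟩

variable [T2Space 𝓜]

theorem Holonomy.trans {x y z : 𝓜} (h : S.Holonomy x y) (h' : S.Holonomy y z) :
    S.Holonomy x z := by
  obtain ⟨θ, hθ, rfl, hθS⟩ := h
  obtain ⟨θ', hθ', rfl, hθS'⟩ := h'
  refine ⟨θ ∘ θ', hθ.comp z hθ', rfl, ?_⟩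
  filter_upwards [hθS', hθ'.continuousAt.eventually hθS] with w hw' hw
  exact hw'.trans hw

theorem SameWorldline.holonomy {x y : 𝓜} (h : S.SameWorldline x y) : S.Holonomy x y := by
  obtain ⟨l, u, γ, hx, hy, hγ, hγx, hγy⟩ := sameWorldline_iff.1 h
  rw [← hγx, ← hγy]
  exact isPreconnected_Ioo.induction₂' (fun s s' => S.Holonomy (γ s) (γ s'))
    (fun s hs => mem_nhdsWithin_of_mem_nhds
      (eventually_holonomy_of_isMIntegralCurveOn isOpen_Ioo hγ hs))
    (fun _ _ _ _ _ _ => Holonomy.trans) hx hy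

end FlowBoxes

section WorldlineSpace

variable [T2Space 𝓜] (S : PreSpacetime n 𝓜 I)

/-- Lying on a common worldline, as an equivalence relation. -/
def worldlineSetoid : Setoid 𝓜 :=
  ⟨S.SameWorldline, SameWorldline.refl, SameWorldline.symm, SameWorldline.trans⟩

/-- The space of worldlines, i.e. the direct limit of the time slices along the flow. -/
def WorldlineSpace : Type u := Quotient S.worldlineSetoid

/-- The worldline of a point. -/
def worldline (x : 𝓜) : S.WorldlineSpace := Quotient.mk S.worldlineSetoid x

theorem worldline_eq_iff {x y : 𝓜} : S.worldline x = S.worldline y ↔ S.SameWorldline x y :=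
  Quotient.eq (r := S.worldlineSetoid)

theorem worldline_surjective : Function.Surjective S.worldline := Quotient.mk_surjective

theorem injOn_worldline_slice (t : ℝ) : InjOn S.worldline (S.slice t) := fun _ hx _ hy h =>
  (S.worldline_eq_iff.1 h).eq_of_time_eq (hx.trans hy.symm)

instance : TopologicalSpace S.WorldlineSpace := inferInstanceAs (TopologicalSpace (Quotient _))

theorem isQuotientMap_worldline : Topology.IsQuotientMap S.worldline := isQuotientMap_quotient_mk'

theorem continuous_worldline : Continuous S.worldline := S.isQuotientMap_worldline.continuous

theorem isOpenMap_worldline : IsOpenMap S.worldline := by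
  intro U hU
  rw [← S.isQuotientMap_worldline.isOpen_preimage, isOpen_iff_mem_nhds]
  rintro y ⟨x, hx, hxy⟩
  obtain ⟨θ, hθ, rfl, hθS⟩ := (S.worldline_eq_iff.1 hxy).holonomy
  filter_upwards [hθS, hθ.continuousAt.preimage_mem_nhds (hU.mem_nhds hx)] with z hz hzU
  exact ⟨θ z, hzU, (S.worldline_eq_iff.2 hz).symm⟩

instance [SecondCountableTopology 𝓜] : SecondCountableTopology S.WorldlineSpace :=
  S.isQuotientMap_worldline.secondCountableTopology S.isOpenMap_worldline

instance [ConnectedSpace 𝓜] : ConnectedSpace S.WorldlineSpace :=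
  S.worldline_surjective.connectedSpace S.continuous_worldline

namespace IsFlowBox

variable {S} {F : OpenPartialHomeomorph 𝓜 (EuclideanSpace ℝ (Fin n) × ℝ)} (hF : S.IsFlowBox F)

/-- The worldlines in a flow box, parametrized by their spatial coordinates. -/
def leaf (b : EuclideanSpace ℝ (Fin n)) : S.WorldlineSpace :=
  S.worldline (F.symm (b, hF.centerTime))

theorem leaf_eq {b : EuclideanSpace ℝ (Fin n)} {t : ℝ} (h : (b, t) ∈ F.target) :
    hF.leaf b = S.worldline (F.symm (b, t)) :=
  S.worldline_eq_iff.2 (hF.sameWorldline_symm (hF.prodMk_centerTime_mem ⟨_, h, rfl⟩) h)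

theorem leaf_fst {z : 𝓜} (hz : z ∈ F.source) : hF.leaf (F z).1 = S.worldline z :=
  (hF.leaf_eq (b := (F z).1) (t := (F z).2) (F.map_source hz)).trans
    (congrArg S.worldline (F.left_inv hz))

theorem injOn_leaf : InjOn hF.leaf (Prod.fst '' F.target) := by
  intro b hb b' hb' h
  have hq := hF.prodMk_centerTime_mem hb
  have hq' := hF.prodMk_centerTime_mem hb'
  exact congrArg Prod.fst
    (F.symm.injOn hq hq' (S.injOn_worldline_slice _ (hF.time_symm hq) (hF.time_symm hq') h))

theorem continuousOn_leaf : ContinuousOn hF.leaf (Prod.fst '' F.target) :=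
  S.continuous_worldline.comp_continuousOn
    (F.continuousOn_symm.comp (by fun_prop) fun _ hb => hF.prodMk_centerTime_mem hb)

theorem isOpenMap_leaf : IsOpenMap ((Prod.fst '' F.target).domRestrict hF.leaf) := by
  intro V hV
  obtain ⟨U, hU, rfl⟩ := isOpen_induced_iff.1 hV
  have himage : (Prod.fst '' F.target).domRestrict hF.leaf '' (Subtype.val ⁻¹' U)
      = S.worldline '' (F.symm '' (F.target ∩ Prod.fst ⁻¹' U)) := by
    ext p
    constructor
    · rintro ⟨⟨b, hb⟩, hbU, rfl⟩
      exact ⟨_, ⟨_, ⟨hF.prodMk_centerTime_mem hb, hbU⟩, rfl⟩, rfl⟩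
    · rintro ⟨_, ⟨⟨b, t⟩, ⟨hq, hqU⟩, rfl⟩, rfl⟩
      exact ⟨⟨b, ⟨_, hq, rfl⟩⟩, hqU, hF.leaf_eq hq⟩
  rw [himage]
  exact S.isOpenMap_worldline _ (F.isOpen_image_symm_of_subset_target
    (F.open_target.inter (hU.preimage continuous_fst)) inter_subset_left)

/-- The chart of the space of worldlines given by a flow box. -/
def leafChart : OpenPartialHomeomorph S.WorldlineSpace (EuclideanSpace ℝ (Fin n)) :=
  (OpenPartialHomeomorph.ofContinuousOpenRestrict (hF.injOn_leaf.toPartialEquiv _ _)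
    hF.continuousOn_leaf hF.isOpenMap_leaf (isOpenMap_fst _ F.open_target)).symm

theorem fst_mem_leafChart_target {z : 𝓜} (hz : z ∈ F.source) : (F z).1 ∈ hF.leafChart.target :=
  ⟨_, F.map_source hz, rfl⟩

theorem worldline_mem_leafChart_source {z : 𝓜} (hz : z ∈ F.source) :
    S.worldline z ∈ hF.leafChart.source :=
  hF.leaf_fst hz ▸ hF.leafChart.map_target (hF.fst_mem_leafChart_target hz)

theorem leafChart_worldline {z : 𝓜} (hz : z ∈ F.source) :
    hF.leafChart (S.worldline z) = (F z).1 := by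
  rw [← hF.leaf_fst hz]
  exact hF.leafChart.right_inv (hF.fst_mem_leafChart_target hz)

theorem leafChart_worldline_time {z : 𝓜} (hz : z ∈ F.source) :
    (hF.leafChart (S.worldline z), S.time z) = F z :=
  Prod.ext (hF.leafChart_worldline hz) (hF.snd_eq z hz).symm

theorem contMDiffAt_leafChart_worldline {y : 𝓜} (hy : S.worldline y ∈ hF.leafChart.source) :
    ContMDiffAt (𝓡 (n + 1)) (𝓡 n) ∞ (fun z => hF.leafChart (S.worldline z)) y := by
  have hb := hF.prodMk_centerTime_mem (hF.leafChart.map_source hy)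
  have hxy : S.worldline (F.symm (hF.leafChart (S.worldline y), hF.centerTime)) = S.worldline y :=
    hF.leafChart.left_inv hy
  obtain ⟨θ, hθ, hθy, hθS⟩ := (S.worldline_eq_iff.1 hxy).holonomy
  have hθF : θ y ∈ F.source := hθy ▸ F.map_target hb
  refine ((hF.contMDiffAt_fst hθF).comp y hθ).congr_of_eventuallyEq ?_
  filter_upwards [hθS, hθ.continuousAt.preimage_mem_nhds (F.open_source.mem_nhds hθF)] with z hz hzF
  rw [S.worldline_eq_iff.2 hz, hF.leafChart_worldline hzF]
  rfl

end IsFlowBox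

/-- The chart of the space of worldlines given by the flow box around `x`. -/
def worldlineChart (x : 𝓜) : OpenPartialHomeomorph S.WorldlineSpace (EuclideanSpace ℝ (Fin n)) :=
  (S.isFlowBox_box x).leafChart

theorem worldline_mem_worldlineChart_source (x : 𝓜) :
    S.worldline x ∈ (S.worldlineChart x).source :=
  (S.isFlowBox_box x).worldline_mem_leafChart_source (S.mem_box_source x)

instance : ChartedSpace (EuclideanSpace ℝ (Fin n)) S.WorldlineSpace where
  atlas := range S.worldlineChart
  chartAt p := S.worldlineChart (Quotient.out p)
  mem_chart_source p := by
    have h := S.worldline_mem_worldlineChart_source (Quotient.out p)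
    rwa [show S.worldline (Quotient.out p) = p from Quotient.out_eq p] at h
  chart_mem_atlas p := mem_range_self _

instance : IsManifold (𝓡 n) ∞ S.WorldlineSpace := by
  refine isManifold_of_contDiffOn _ _ _ ?_
  rintro _ _ ⟨x, rfl⟩ ⟨x', rfl⟩ b ⟨⟨hb, hb'⟩, -⟩
  have hsymm := (S.isFlowBox_box x).contMDiffAt_symm_prodMk
    ((S.isFlowBox_box x).prodMk_centerTime_mem hb)
  have hcoord := (S.isFlowBox_box x').contMDiffAt_leafChart_worldline hb'
  exact (ContMDiffAt.comp b hcoord hsymm).contDiffAt.contDiffWithinAt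

theorem contMDiff_worldline : ContMDiff (𝓡 (n + 1)) (𝓡 n) ∞ S.worldline := fun x =>
  contMDiffAt_iff_target.2 ⟨S.continuous_worldline.continuousAt,
    (S.isFlowBox_box _).contMDiffAt_leafChart_worldline (mem_chart_source _ (S.worldline x))⟩

theorem contMDiffAt_worldlineChart (x : 𝓜) :
    ContMDiffAt (𝓡 n) (𝓡 n) ∞ (S.worldlineChart x) (S.worldline x) :=
  (contMDiffOn_of_mem_maximalAtlas
    (IsManifold.subset_maximalAtlas (mem_range_self x))).contMDiffAt
      ((S.worldlineChart x).open_source.mem_nhds (S.worldline_mem_worldlineChart_source x))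

end WorldlineSpace

end PreSpacetime

theorem isOpenMap_of_eventually_rightInverse {X Y : Type*} [TopologicalSpace X]
    [TopologicalSpace Y] {f : X → Y} (h : ∀ x, ∃ g : Y → X, ContinuousAt g (f x) ∧ g (f x) = x ∧
      ∀ᶠ y in 𝓝 (f x), f (g y) = y) : IsOpenMap f := by
  rw [isOpenMap_iff_nhds_le]
  intro x
  obtain ⟨g, hg, hgx, hfg⟩ := h x
  calc 𝓝 (f x) = Filter.map (f ∘ g) (𝓝 (f x)) :=
        Filter.map_id.symm.trans (Filter.map_congr hfg).symm
    _ = Filter.map f (Filter.map g (𝓝 (f x))) := Filter.map_map.symm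
    _ ≤ Filter.map f (𝓝 x) := Filter.map_mono (hg.tendsto.trans_eq (by rw [hgx]))

namespace PreSpacetime

variable {n : ℕ} {𝓜 : Type u} [TopologicalSpace 𝓜]
  [ChartedSpace (EuclideanSpace ℝ (Fin (n + 1))) 𝓜] [IsManifold (𝓡 (n + 1)) ∞ 𝓜] [T2Space 𝓜]
  {I : Set ℝ} (S : PreSpacetime n 𝓜 I)

/-- The map `x ↦ (worldline of x, 𝔱 x)`, which will be the map `Φ` of the theorem. -/
def toProd (x : 𝓜) : S.WorldlineSpace × ℝ := (S.worldline x, S.time x)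

theorem toProd_injective : Function.Injective S.toProd := fun _ y h =>
  S.injOn_worldline_slice (S.time y) (congrArg Prod.snd h) rfl (congrArg Prod.fst h)

theorem contMDiff_toProd : ContMDiff (𝓡 (n + 1)) ((𝓡 n).prod 𝓘(ℝ, ℝ)) ∞ S.toProd :=
  S.contMDiff_worldline.prodMk S.time_smooth

/-- The inverse of `toProd` near the image of `x`, read off from the flow box around `x`. -/
def toProdLocalInverse (x : 𝓜) (q : S.WorldlineSpace × ℝ) : 𝓜 :=
  (S.box x).symm (S.worldlineChart x q.1, q.2)

theorem worldlineChart_prodMk_time (x : 𝓜) :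
    (S.worldlineChart x (S.toProd x).1, (S.toProd x).2) = S.box x x :=
  (S.isFlowBox_box x).leafChart_worldline_time (S.mem_box_source x)

theorem toProdLocalInverse_toProd (x : 𝓜) : S.toProdLocalInverse x (S.toProd x) = x := by
  rw [toProdLocalInverse, worldlineChart_prodMk_time, (S.box x).left_inv (S.mem_box_source x)]

theorem contMDiffAt_toProdLocalInverse (x : 𝓜) :
    ContMDiffAt ((𝓡 n).prod 𝓘(ℝ, ℝ)) (𝓡 (n + 1)) ∞ (S.toProdLocalInverse x) (S.toProd x) := by
  have hcoord : ContMDiffAt ((𝓡 n).prod 𝓘(ℝ, ℝ)) 𝓘(ℝ, EuclideanSpace ℝ (Fin n) × ℝ) ∞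
      (fun q : S.WorldlineSpace × ℝ => (S.worldlineChart x q.1, q.2)) (S.toProd x) :=
    (ContMDiffAt.comp (f := Prod.fst) (S.toProd x) (S.contMDiffAt_worldlineChart x)
      contMDiffAt_fst).prodMk_space contMDiffAt_snd
  refine ((S.isFlowBox_box x).contMDiffOn_symm.contMDiffAt
    ((S.box x).open_target.mem_nhds ?_)).comp (S.toProd x) hcoord
  rw [worldlineChart_prodMk_time]
  exact (S.box x).map_source (S.mem_box_source x)

theorem eventually_toProd_toProdLocalInverse (x : 𝓜) :
    ∀ᶠ q in 𝓝 (S.toProd x), S.toProd (S.toProdLocalInverse x q) = q := by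
  have hsource := (S.worldlineChart x).open_source.mem_nhds
    (S.worldline_mem_worldlineChart_source x)
  have hcoord : ContinuousAt (fun q : S.WorldlineSpace × ℝ => (S.worldlineChart x q.1, q.2))
      (S.toProd x) :=
    ((S.contMDiffAt_worldlineChart x).continuousAt.comp (x := S.toProd x)
      (f := Prod.fst) continuousAt_fst).prodMk continuousAt_snd
  have htarget : (S.worldlineChart x (S.toProd x).1, (S.toProd x).2) ∈ (S.box x).target := by
    rw [worldlineChart_prodMk_time]
    exact (S.box x).map_source (S.mem_box_source x)
  filter_upwards [hcoord.preimage_mem_nhds ((S.box x).open_target.mem_nhds htarget),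
    continuousAt_fst.preimage_mem_nhds hsource] with q hq hq'
  exact Prod.ext (((S.isFlowBox_box x).leaf_eq hq).symm.trans ((S.worldlineChart x).left_inv hq'))
    ((S.isFlowBox_box x).time_symm hq)

theorem isOpenMap_toProd : IsOpenMap S.toProd := isOpenMap_of_eventually_rightInverse fun x =>
  ⟨S.toProdLocalInverse x, (S.contMDiffAt_toProdLocalInverse x).continuousAt,
    S.toProdLocalInverse_toProd x, S.eventually_toProd_toProdLocalInverse x⟩

theorem isOpen_image_worldline_slice {U : Set 𝓜} (hU : IsOpen U) (t : ℝ) :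
    IsOpen (S.worldline '' (S.slice t ∩ U)) := by
  have himage : S.worldline '' (S.slice t ∩ U) = (fun p => (p, t)) ⁻¹' (S.toProd '' U) := by
    ext p
    constructor
    · rintro ⟨x, ⟨hxt, hx⟩, rfl⟩
      exact ⟨x, hx, Prod.ext rfl hxt⟩
    · rintro ⟨x, hx, h⟩
      exact ⟨x, ⟨congrArg Prod.snd h, hx⟩, congrArg Prod.fst h⟩
  rw [himage]
  exact (S.isOpenMap_toProd U hU).preimage (by fun_prop)

section Inverse

variable [Nonempty 𝓜]

/-- A left inverse of `toProd`; its values off the range of `toProd` are arbitrary. -/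
def ofProd : S.WorldlineSpace × ℝ → 𝓜 := Function.invFun S.toProd

theorem ofProd_toProd (x : 𝓜) : S.ofProd (S.toProd x) = x :=
  Function.leftInverse_invFun S.toProd_injective x

theorem ofProd_worldline_of_mem_slice {t : ℝ} {x : 𝓜} (hx : x ∈ S.slice t) :
    S.ofProd (S.worldline x, t) = x := by
  obtain rfl : S.time x = t := hx
  exact S.ofProd_toProd x

theorem contMDiffOn_ofProd :
    ContMDiffOn ((𝓡 n).prod 𝓘(ℝ, ℝ)) (𝓡 (n + 1)) ∞ S.ofProd (range S.toProd) := by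
  rintro _ ⟨x, rfl⟩
  refine ((S.contMDiffAt_toProdLocalInverse x).congr_of_eventuallyEq ?_).contMDiffWithinAt
  filter_upwards [S.eventually_toProd_toProdLocalInverse x] with q hq
  conv_lhs => rw [← hq]
  exact S.ofProd_toProd _

theorem isDiffeoOntoOpenImageOn_toProd :
    IsDiffeoOntoOpenImageOn (𝓡 (n + 1)) ((𝓡 n).prod 𝓘(ℝ, ℝ)) univ S.toProd :=
  ⟨S.contMDiff_toProd.contMDiffOn, S.isOpenMap_toProd _ isOpen_univ, S.ofProd,
    image_univ ▸ S.contMDiffOn_ofProd, fun x _ => S.ofProd_toProd x⟩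

theorem isDiffeoOntoOpenImageOn_worldline_slice (t : ℝ) :
    IsDiffeoOntoOpenImageOn (𝓡 (n + 1)) (𝓡 n) (S.slice t) S.worldline := by
  refine ⟨S.contMDiff_worldline.contMDiffOn, ?_, fun p => S.ofProd (p, t), ?_,
    fun x hx => S.ofProd_worldline_of_mem_slice hx⟩
  · exact inter_univ (S.slice t) ▸ S.isOpen_image_worldline_slice isOpen_univ t
  · refine S.contMDiffOn_ofProd.comp (contMDiff_id.prodMk contMDiff_const).contMDiffOn ?_
    rintro _ ⟨x, hx, rfl⟩
    exact ⟨x, Prod.ext rfl hx⟩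

end Inverse

variable {S} in
theorem t2Space_worldlineSpace
    (hS : ∀ x, ∀ t ∈ I, S.time x ≤ t → t ∈ S.worldlineDomain x) : T2Space S.WorldlineSpace := by
  have exists_mem_slice (x : 𝓜) {t : ℝ} (ht : t ∈ I) (hxt : S.time x ≤ t) :
      ∃ x' ∈ S.slice t, S.worldline x' = S.worldline x := by
    obtain ⟨x', hx'⟩ := hS x t ht hxt
    exact ⟨x', hx'.time_eq, (S.worldline_eq_iff.2 ⟨t, hx'⟩).symm⟩
  refine ⟨S.worldline_surjective.forall₂.2 fun x y hxy => ?_⟩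
  have ht : max (S.time x) (S.time y) ∈ I := by
    rcases max_choice (S.time x) (S.time y) with h | h <;> rw [h]
    exacts [S.time_mem x, S.time_mem y]
  obtain ⟨x', hx't, hx'⟩ := exists_mem_slice x ht (le_max_left _ _)
  obtain ⟨y', hy't, hy'⟩ := exists_mem_slice y ht (le_max_right _ _)
  rw [← hx', ← hy'] at hxy ⊢
  obtain ⟨U, V, hU, hV, hxU, hyV, hUV⟩ := t2_separation (fun h => hxy (congrArg _ h))
  refine ⟨_, _, S.isOpen_image_worldline_slice hU _, S.isOpen_image_worldline_slice hV _,
    mem_image_of_mem _ ⟨hx't, hxU⟩, mem_image_of_mem _ ⟨hy't, hyV⟩, ?_⟩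
  exact (hUV.mono inter_subset_right inter_subset_right).image (S.injOn_worldline_slice _)
    inter_subset_left inter_subset_left

end PreSpacetime

theorem IsExpanding.mem_worldlineDomain {n : ℕ} {𝓜 : Type u} [TopologicalSpace 𝓜]
    [ChartedSpace (EuclideanSpace ℝ (Fin (n + 1))) 𝓜] [IsManifold (𝓡 (n + 1)) ∞ 𝓜]
    {T : EReal} {S : RicciFlowSpacetime n 𝓜 (timeInterval T)} (hS : IsExpanding S) {x : 𝓜} {t : ℝ}
    (htT : (t : EReal) < T) (hxt : S.time x ≤ t) : t ∈ S.worldlineDomain x := by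
  rw [← hS x, PreSpacetime.vanishingTime, lt_sSup_iff] at htT
  obtain ⟨_, ⟨s, hs, rfl⟩, hts⟩ := htT
  exact PreSpacetime.mem_worldlineDomain_of_le hs hxt (EReal.coe_lt_coe_iff.1 hts).le

/-! ### The pushed forward metric -/

section GermCongruence

variable {n : ℕ} {y : EuclideanSpace ℝ (Fin n)}

theorem pderiv_congr {k : Fin n} {f f' : EuclideanSpace ℝ (Fin n) → ℝ} (h : f =ᶠ[𝓝 y] f') :
    pderiv k f y = pderiv k f' y := by
  rw [pderiv, pderiv, h.fderiv_eq]

variable {G G' : EuclideanSpace ℝ (Fin n) → Matrix (Fin n) (Fin n) ℝ}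

theorem christoffel_congr (h : G =ᶠ[𝓝 y] G') (k i j : Fin n) :
    christoffel G k i j y = christoffel G' k i j y := by
  have hentry : ∀ a b, (fun z => G z a b) =ᶠ[𝓝 y] fun z => G' z a b := fun a b =>
    h.mono fun z hz => congrFun₂ hz a b
  simp only [christoffel, h.eq_of_nhds, pderiv_congr (hentry _ _)]

theorem ricciCoord_congr (h : G =ᶠ[𝓝 y] G') (a b : EuclideanSpace ℝ (Fin n)) :
    ricciCoord G y a b = ricciCoord G' y a b := by
  have hΓ : ∀ k i j, christoffel G k i j =ᶠ[𝓝 y] christoffel G' k i j := fun k i j =>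
    h.eventually_nhds.mono fun z hz => christoffel_congr hz k i j
  simp only [ricciCoord, ricciCoeff, pderiv_congr (hΓ _ _ _), (hΓ _ _ _).eq_of_nhds]

end GermCongruence

section Mfderiv

variable {E E' F H H' N N' : Type*} [NormedAddCommGroup E] [NormedSpace ℝ E]
  [NormedAddCommGroup E'] [NormedSpace ℝ E'] [NormedAddCommGroup F] [NormedSpace ℝ F]
  [TopologicalSpace H] [TopologicalSpace H'] {I : ModelWithCorners ℝ E H}
  {I' : ModelWithCorners ℝ E' H'} [TopologicalSpace N] [ChartedSpace H N] [TopologicalSpace N']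
  [ChartedSpace H' N']

theorem isInvertible_mfderiv_of_eventually_inverse {f : N → N'} {g : N' → N} {x : N}
    (hf : MDifferentiableAt I I' f x) (hg : MDifferentiableAt I' I g (f x))
    (hgf : g ∘ f =ᶠ[𝓝 x] id) (hfg : f ∘ g =ᶠ[𝓝 (f x)] id) :
    (mfderiv I I' f x).IsInvertible := by
  have hgx : g (f x) = x := hgf.eq_of_nhds
  have hleft := mfderiv_comp x hg hf
  have hright := mfderiv_comp (f x) (hgx.symm ▸ hf) hg
  rw [hgf.mfderiv_eq, mfderiv_id] at hleft
  rw [hfg.mfderiv_eq, mfderiv_id, hgx] at hright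
  exact .of_inverse hright.symm hleft.symm

theorem mlieBracket_mpullback_const [CompleteSpace E] [CompleteSpace F] [IsManifold I ∞ N]
    {f : N → F} {x : N} (hf : ContMDiffAt I 𝓘(ℝ, F) ∞ f x) (c d : F) :
    VectorField.mlieBracket I (VectorField.mpullback I 𝓘(ℝ, F) f fun _ => c)
      (VectorField.mpullback I 𝓘(ℝ, F) f fun _ => d) x = 0 := by
  have h2 : minSmoothness ℝ 2 ≤ (∞ : ℕ∞ω) :=
    minSmoothness_of_isRCLikeNormedField.trans_le ENat.LEInfty.out
  have h3 : minSmoothness ℝ 3 ≤ (∞ : ℕ∞ω) :=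
    minSmoothness_of_isRCLikeNormedField.trans_le ENat.LEInfty.out
  have : IsManifold I (minSmoothness ℝ 3) N := .of_le h3
  have hconst (c : F) : MDifferentiableAt 𝓘(ℝ, F) 𝓘(ℝ, F).tangent
      (fun q => (⟨q, c⟩ : TangentBundle 𝓘(ℝ, F) F)) (f x) :=
    (contMDiffAt_vectorSpace_iff_contDiffAt.2 (contDiffAt_const (n := 1))).mdifferentiableAt
      one_ne_zero
  have hlie : VectorField.lieBracketWithin ℝ (fun _ => c) (fun _ => d) univ (f x) = 0 := by
    simp [VectorField.lieBracketWithin]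
  have hmlie : VectorField.mlieBracket 𝓘(ℝ, F) (fun _ => c) (fun _ => d) (f x) = (0 : F) :=
    (congrFun VectorField.mlieBracketWithin_univ.symm (f x)).trans
      ((congrFun VectorField.mlieBracketWithin_eq_lieBracketWithin (f x)).trans hlie)
  rw [← VectorField.mpullback_mlieBracket (hconst c) (hconst d) hf h2, VectorField.mpullback_apply]
  exact (congrArg _ hmlie).trans (map_zero _)

end Mfderiv

section CoordField

variable {E H N : Type*} [NormedAddCommGroup E] [NormedSpace ℝ E] [TopologicalSpace H]
  {I : ModelWithCorners ℝ E H} [TopologicalSpace N] [ChartedSpace H N]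

variable (I) in
/-- The coordinate vector field of the preferred chart at `p` with constant coefficients `a`; it is
only meaningful on the domain of that chart. -/
def coordField (p : N) (a : E) : ∀ q : N, TangentSpace I q :=
  VectorField.mpullback I 𝓘(ℝ, E) (extChartAt I p) fun _ => a

variable [IsManifold I 1 N] {p : N}

theorem mfderiv_coordField (a : E) {q : N} (hq : q ∈ (extChartAt I p).source) :
    mfderiv I 𝓘(ℝ, E) (extChartAt I p) q (coordField I p a q) = a :=
  (isInvertible_mfderiv_extChartAt hq).self_apply_inverse a

theorem coordField_mfderiv {q : N} (hq : q ∈ (extChartAt I p).source) (v : TangentSpace I q) :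
    coordField I p (mfderiv I 𝓘(ℝ, E) (extChartAt I p) q v) q = v :=
  (isInvertible_mfderiv_extChartAt hq).inverse_apply_self v

theorem coordField_extChartAt_symm [I.Boundaryless] (a : E) {y : E}
    (hy : y ∈ (extChartAt I p).target) :
    coordField I p a ((extChartAt I p).symm y) = mfderiv 𝓘(ℝ, E) I (extChartAt I p).symm y a := by
  have h := mfderiv_extChartAt_comp_mfderivWithin_extChartAt_symm (I := I) hy
  rw [I.range_eq_univ, mfderivWithin_univ] at h
  refine Eq.trans ?_ (coordField_mfderiv ((extChartAt I p).map_target hy) _)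
  exact congrArg (coordField I p · _) (DFunLike.congr_fun h a).symm

end CoordField

theorem smoothFieldOn_coordField {m : ℕ} {N : Type u} [TopologicalSpace N]
    [ChartedSpace (EuclideanSpace ℝ (Fin m)) N] [IsManifold (𝓡 m) ∞ N] (p : N)
    (a : EuclideanSpace ℝ (Fin m)) :
    SmoothFieldOn (coordField (𝓡 m) p a) (extChartAt (𝓡 m) p).source := by
  intro q hq
  have hconst : ContMDiffAt (𝓡 m) (𝓡 m).tangent ∞
      (fun y => (⟨y, a⟩ : TangentBundle (𝓡 m) (EuclideanSpace ℝ (Fin m)))) (extChartAt (𝓡 m) p q) :=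
    contMDiffAt_vectorSpace_iff_contDiffAt.2 contDiffAt_const
  exact (hconst.mpullback_vectorField_preimage
    (contMDiffAt_extChartAt' (n := ∞) (extChartAt_source (𝓡 m) p ▸ hq))
    (isInvertible_mfderiv_extChartAt hq) (by simp)).contMDiffWithinAt

namespace PreSpacetime

variable {n : ℕ} {𝓜 : Type u} [TopologicalSpace 𝓜]
  [ChartedSpace (EuclideanSpace ℝ (Fin (n + 1))) 𝓜] [IsManifold (𝓡 (n + 1)) ∞ 𝓜]
  {I : Set ℝ} (S : PreSpacetime n 𝓜 I)

theorem proj_coe {x : 𝓜} (v : spat n S.time x) : S.proj x v = v := by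
  have hv : mvfderiv (𝓡 (n + 1)) S.time x v.1 = 0 := v.2
  exact Subtype.ext (by simp [proj, hv])

theorem met_coe {x : 𝓜} (v w : spat n S.time x) : S.met x v w = S.g x v w := by
  rw [met, proj_coe, proj_coe]

theorem met_zero_left (x : 𝓜) (w : TangentSpace (𝓡 (n + 1)) x) : S.met x 0 w = 0 := by
  have h : S.proj x 0 = 0 := S.proj_coe 0
  rw [met, h, map_zero, LinearMap.zero_apply]

theorem met_zero_right (x : 𝓜) (v : TangentSpace (𝓡 (n + 1)) x) : S.met x v 0 = 0 := by
  have h : S.proj x 0 = 0 := S.proj_coe 0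
  rw [met, h, map_zero]

theorem lieDerivMetric_of_mlieBracket_eq_zero {X Y : ∀ x : 𝓜, spat n S.time x} {x : 𝓜}
    (hX : VectorField.mlieBracket (𝓡 (n + 1)) S.dt (fun z => (X z).1) x = 0)
    (hY : VectorField.mlieBracket (𝓡 (n + 1)) S.dt (fun z => (Y z).1) x = 0) :
    S.lieDerivMetric X Y x
      = mvfderiv (𝓡 (n + 1)) (fun z => S.g z (X z) (Y z)) x (S.dt x) := by
  rw [lieDerivMetric, hX, hY, met_zero_left, met_zero_right, sub_zero, sub_zero]

variable [T2Space 𝓜]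

section Lift

theorem mdifferentiableAt_toProd (x : 𝓜) :
    MDifferentiableAt (𝓡 (n + 1)) ((𝓡 n).prod 𝓘(ℝ, ℝ)) S.toProd x :=
  S.contMDiff_toProd.mdifferentiableAt (by simp)

theorem mdifferentiableAt_worldline (x : 𝓜) :
    MDifferentiableAt (𝓡 (n + 1)) (𝓡 n) S.worldline x :=
  S.contMDiff_worldline.mdifferentiableAt (by simp)

theorem mfderiv_toProd (x : 𝓜) (v : TangentSpace (𝓡 (n + 1)) x) :
    mfderiv (𝓡 (n + 1)) ((𝓡 n).prod 𝓘(ℝ, ℝ)) S.toProd x v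
      = (mfderiv (𝓡 (n + 1)) (𝓡 n) S.worldline x v, mvfderiv (𝓡 (n + 1)) S.time x v) :=
  DFunLike.congr_fun (mfderiv_prodMk (S.mdifferentiableAt_worldline x)
    (S.time_smooth.mdifferentiableAt (by simp))) v

theorem isInvertible_mfderiv_toProd (x : 𝓜) :
    (mfderiv (𝓡 (n + 1)) ((𝓡 n).prod 𝓘(ℝ, ℝ)) S.toProd x).IsInvertible := by
  refine isInvertible_mfderiv_of_eventually_inverse (S.mdifferentiableAt_toProd x)
    ((S.contMDiffAt_toProdLocalInverse x).mdifferentiableAt (by simp)) ?_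
    (S.eventually_toProd_toProdLocalInverse x)
  filter_upwards [S.contMDiff_toProd.continuous.continuousAt.eventually
    (S.eventually_toProd_toProdLocalInverse x)] with z hz
  exact S.toProd_injective hz

/-- The unique spatial vector at `x` which projects to the given tangent vector of the space of
worldlines. The tangent spaces of the latter are identified with `ℝⁿ`, so that the vectors at one
worldline can be lifted to all of its points. -/
def lift (x : 𝓜) : EuclideanSpace ℝ (Fin n) →ₗ[ℝ] spat n S.time x :=
  LinearMap.codRestrict _
    ((mfderiv (𝓡 (n + 1)) ((𝓡 n).prod 𝓘(ℝ, ℝ)) S.toProd x).inverse.toLinearMap ∘ₗ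
      LinearMap.inl ℝ (EuclideanSpace ℝ (Fin n)) ℝ)
    fun v => (congrArg Prod.snd (S.mfderiv_toProd x _)).symm.trans
      (congrArg Prod.snd ((S.isInvertible_mfderiv_toProd x).self_apply_inverse (v, (0 : ℝ))))

theorem mfderiv_toProd_lift (x : 𝓜) (v : EuclideanSpace ℝ (Fin n)) :
    mfderiv (𝓡 (n + 1)) ((𝓡 n).prod 𝓘(ℝ, ℝ)) S.toProd x (S.lift x v).1 = (v, (0 : ℝ)) :=
  (S.isInvertible_mfderiv_toProd x).self_apply_inverse _

theorem mfderiv_worldline_lift (x : 𝓜) (v : EuclideanSpace ℝ (Fin n)) :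
    mfderiv (𝓡 (n + 1)) (𝓡 n) S.worldline x (S.lift x v).1 = v :=
  congrArg Prod.fst ((S.mfderiv_toProd x _).symm.trans (S.mfderiv_toProd_lift x v))

theorem lift_injective (x : 𝓜) : Function.Injective (S.lift x) := fun v w h => by
  rw [← S.mfderiv_worldline_lift x v, h, S.mfderiv_worldline_lift]

theorem lift_mfderiv_worldline {x : 𝓜} (u : spat n S.time x) :
    S.lift x (mfderiv (𝓡 (n + 1)) (𝓡 n) S.worldline x u.1) = u := by
  refine Subtype.ext ((S.isInvertible_mfderiv_toProd x).injective ?_)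
  exact (S.mfderiv_toProd_lift x _).trans
    ((S.mfderiv_toProd x _).trans (congrArg (Prod.mk _) u.2)).symm

theorem smoothFieldOn_lift {W : Set S.WorldlineSpace} (hW : IsOpen W)
    {X : ∀ p : S.WorldlineSpace, TangentSpace (𝓡 n) p} (hX : SmoothFieldOn X W) :
    SmoothFieldOn (fun x => (S.lift x (X (S.worldline x))).1) (S.worldline ⁻¹' W) := by
  intro x hx
  have hfst : ContMDiffAt ((𝓡 n).prod 𝓘(ℝ, ℝ)) (𝓡 n).tangent ∞
      (fun q : S.WorldlineSpace × ℝ => (⟨q.1, X q.1⟩ : TangentBundle (𝓡 n) S.WorldlineSpace))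
      (S.toProd x) :=
    ContMDiffAt.comp (f := Prod.fst) (S.toProd x) (hX.contMDiffAt (hW.mem_nhds hx)) contMDiffAt_fst
  have hzero (t : ℝ) : ContMDiffAt 𝓘(ℝ, ℝ) 𝓘(ℝ, ℝ).tangent ∞
      (fun t : ℝ => (⟨t, (0 : ℝ)⟩ : TangentBundle 𝓘(ℝ, ℝ) ℝ)) t :=
    contMDiffAt_vectorSpace_iff_contDiffAt.2 contDiffAt_const
  have hsnd : ContMDiffAt ((𝓡 n).prod 𝓘(ℝ, ℝ)) 𝓘(ℝ, ℝ).tangent ∞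
      (fun q : S.WorldlineSpace × ℝ => (⟨q.2, (0 : ℝ)⟩ : TangentBundle 𝓘(ℝ, ℝ) ℝ))
      (S.toProd x) :=
    ContMDiffAt.comp (f := Prod.snd) (S.toProd x) (hzero _) contMDiffAt_snd
  have hprod : ContMDiffAt ((𝓡 n).prod 𝓘(ℝ, ℝ)) ((𝓡 n).prod 𝓘(ℝ, ℝ)).tangent ∞
      (fun q => (⟨q, (X q.1, (0 : ℝ))⟩ :
        TangentBundle ((𝓡 n).prod 𝓘(ℝ, ℝ)) (S.WorldlineSpace × ℝ))) (S.toProd x) :=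
    ContMDiffAt.comp (S.toProd x) (contMDiff_equivTangentBundleProd_symm (I := 𝓡 n)
      (M := S.WorldlineSpace) (I' := 𝓘(ℝ, ℝ)) (M' := ℝ) (n := ∞)).contMDiffAt
      (hfst.prodMk hsnd)
  exact (hprod.mpullback_vectorField_preimage S.contMDiff_toProd.contMDiffAt
    (S.isInvertible_mfderiv_toProd x) (by simp)).contMDiffWithinAt

end Lift

section TimeCurves

variable [Nonempty 𝓜]

theorem toProd_ofProd {q : S.WorldlineSpace × ℝ} (hq : q ∈ range S.toProd) :
    S.toProd (S.ofProd q) = q :=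
  Function.invFun_eq hq

theorem eventually_toProd_ofProd_worldline (x : 𝓜) :
    ∀ᶠ s in 𝓝 (S.time x), S.toProd (S.ofProd (S.worldline x, s)) = (S.worldline x, s) := by
  have hcont : Continuous fun s : ℝ => (S.worldline x, s) := by fun_prop
  filter_upwards [hcont.continuousAt.preimage_mem_nhds
    (S.isOpenMap_toProd.isOpen_range.mem_nhds (mem_range_self x))] with s hs
  exact S.toProd_ofProd hs

theorem hasMFDerivAt_ofProd_worldline (x : 𝓜) :
    HasMFDerivAt 𝓘(ℝ, ℝ) (𝓡 (n + 1)) (fun s => S.ofProd (S.worldline x, s)) (S.time x)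
      ((1 : ℝ →L[ℝ] ℝ).smulRight (S.dt x)) := by
  have hbox := S.isFlowBox_box x
  have hx := S.mem_box_source x
  have htarget := (S.box x).map_source hx
  have hcurve := hbox.hasMFDerivAt_symm htarget
  rw [(S.box x).left_inv hx, hbox.snd_eq x hx] at hcurve
  refine hcurve.congr_of_eventuallyEq ?_
  have hcont : Continuous fun s : ℝ => ((S.box x x).1, s) := by fun_prop
  have hnhds : (S.box x).target ∈ 𝓝 ((S.box x x).1, S.time x) := by
    rw [← hbox.snd_eq x hx]
    exact (S.box x).open_target.mem_nhds htarget
  filter_upwards [hcont.continuousAt.preimage_mem_nhds hnhds] with s hs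
  have hworldline : S.worldline ((S.box x).symm ((S.box x x).1, s)) = S.worldline x :=
    (hbox.leaf_eq hs).symm.trans (hbox.leaf_fst hx)
  rw [← hworldline]
  exact S.ofProd_worldline_of_mem_slice (hbox.time_symm hs)

end TimeCurves

theorem mfderiv_toProd_dt (x : 𝓜) :
    mfderiv (𝓡 (n + 1)) ((𝓡 n).prod 𝓘(ℝ, ℝ)) S.toProd x (S.dt x)
      = ((0 : EuclideanSpace ℝ (Fin n)), (1 : ℝ)) := by
  have : Nonempty 𝓜 := ⟨x⟩
  have htoProd : HasMFDerivAt (𝓡 (n + 1)) ((𝓡 n).prod 𝓘(ℝ, ℝ)) S.toProd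
      (S.ofProd (S.worldline x, S.time x))
      (mfderiv (𝓡 (n + 1)) ((𝓡 n).prod 𝓘(ℝ, ℝ)) S.toProd x) := by
    rw [S.ofProd_worldline_of_mem_slice rfl]
    exact (S.mdifferentiableAt_toProd x).hasMFDerivAt
  have hline := ((hasMFDerivAt_const (I := 𝓘(ℝ, ℝ)) (I' := 𝓡 n) (S.worldline x)
    (S.time x)).prodMk (hasMFDerivAt_id (S.time x))).congr_of_eventuallyEq
    (S.eventually_toProd_ofProd_worldline x)
  have h := DFunLike.congr_fun (hasMFDerivAt_unique (htoProd.comp (S.time x)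
    (S.hasMFDerivAt_ofProd_worldline x)) hline) (1 : ℝ)
  refine Eq.trans ?_ h
  exact congrArg (mfderiv (𝓡 (n + 1)) ((𝓡 n).prod 𝓘(ℝ, ℝ)) S.toProd x) (one_smul ℝ (S.dt x)).symm

theorem mfderiv_worldline_dt (x : 𝓜) :
    mfderiv (𝓡 (n + 1)) (𝓡 n) S.worldline x (S.dt x) = 0 :=
  congrArg Prod.fst ((S.mfderiv_toProd x _).symm.trans (S.mfderiv_toProd_dt x))

section PushMetric

variable [Nonempty 𝓜]

/-- The push-forward to the space of worldlines of the spatial metric of the slice at time `t`; the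
value at a worldline which does not exist at time `t` is junk. -/
def pushMetric (t : ℝ) (p : S.WorldlineSpace) : LinearMap.BilinForm ℝ (TangentSpace (𝓡 n) p) :=
  (S.g (S.ofProd (p, t))).compl₁₂ (S.lift _) (S.lift _)

theorem pushMetric_apply (x : 𝓜) (v w : TangentSpace (𝓡 n) (S.worldline x)) :
    S.pushMetric (S.time x) (S.worldline x) v w = S.g x (S.lift x v) (S.lift x w) :=
  congrArg (fun z => S.g z (S.lift z v) (S.lift z w)) (S.ofProd_toProd x)

theorem pushMetric_mfderiv (x : 𝓜) (v w : spat n S.time x) :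
    S.pushMetric (S.time x) (S.worldline x) (mfderiv (𝓡 (n + 1)) (𝓡 n) S.worldline x v.1)
      (mfderiv (𝓡 (n + 1)) (𝓡 n) S.worldline x w.1) = S.g x v w :=
  (S.pushMetric_apply x _ _).trans
    (congrArg₂ (S.g x · ·) (S.lift_mfderiv_worldline v) (S.lift_mfderiv_worldline w))

theorem contMDiffOn_pushMetric {W : Set S.WorldlineSpace} (hW : IsOpen W)
    {X Y : ∀ p : S.WorldlineSpace, TangentSpace (𝓡 n) p} (hX : SmoothFieldOn X W)
    (hY : SmoothFieldOn Y W) :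
    ContMDiffOn ((𝓡 n).prod 𝓘(ℝ, ℝ)) 𝓘(ℝ, ℝ) ∞
      (fun q : S.WorldlineSpace × ℝ => S.pushMetric q.2 q.1 (X q.1) (Y q.1))
      (range S.toProd ∩ W ×ˢ univ) := by
  let f (x : 𝓜) : ℝ := S.g x (S.lift x (X (S.worldline x))) (S.lift x (Y (S.worldline x)))
  have hf : ContMDiffOn (𝓡 (n + 1)) 𝓘(ℝ, ℝ) ∞ f (S.worldline ⁻¹' W) :=
    S.g_smooth _ _ _ (hW.preimage S.continuous_worldline) (S.smoothFieldOn_lift hW hX)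
      (S.smoothFieldOn_lift hW hY)
  refine (hf.comp (S.contMDiffOn_ofProd.mono inter_subset_left) ?_).congr ?_
  · rintro _ ⟨⟨x, rfl⟩, hx⟩
    rw [mem_preimage, mem_preimage, S.ofProd_toProd]
    exact hx.1
  · rintro _ ⟨⟨x, rfl⟩, -⟩
    exact (S.pushMetric_apply x _ _).trans (congrArg f (S.ofProd_toProd x)).symm

end PushMetric

section Coords

/-- The coordinates `(y, t)` on `𝓜` given by a chart of the space of worldlines and the time. -/
def coords (p : S.WorldlineSpace) (x : 𝓜) : EuclideanSpace ℝ (Fin n) × ℝ :=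
  (extChartAt (𝓡 n) p (S.worldline x), S.time x)

/-- The spatial lift to `𝓜` of a coordinate field of the space of worldlines. -/
def liftCoordField (p : S.WorldlineSpace) (a : EuclideanSpace ℝ (Fin n)) (x : 𝓜) :
    spat n S.time x :=
  S.lift x (coordField (𝓡 n) p a (S.worldline x))

theorem smoothFieldOn_liftCoordField (p : S.WorldlineSpace) (a : EuclideanSpace ℝ (Fin n)) :
    SmoothFieldOn (fun x => (S.liftCoordField p a x).1)
      (S.worldline ⁻¹' (extChartAt (𝓡 n) p).source) :=
  S.smoothFieldOn_lift (isOpen_extChartAt_source p) (smoothFieldOn_coordField p a)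

variable {S} {p : S.WorldlineSpace} {x : 𝓜} (hx : S.worldline x ∈ (extChartAt (𝓡 n) p).source)
include hx

theorem contMDiffAt_coords :
    ContMDiffAt (𝓡 (n + 1)) 𝓘(ℝ, EuclideanSpace ℝ (Fin n) × ℝ) ∞ (S.coords p) x :=
  ((contMDiffAt_extChartAt' (extChartAt_source (𝓡 n) p ▸ hx)).comp x
    S.contMDiff_worldline.contMDiffAt).prodMk_space S.time_smooth.contMDiffAt

theorem mfderiv_coords (v : TangentSpace (𝓡 (n + 1)) x) :
    mfderiv (𝓡 (n + 1)) 𝓘(ℝ, EuclideanSpace ℝ (Fin n) × ℝ) (S.coords p) x v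
      = (mfderiv (𝓡 n) (𝓡 n) (extChartAt (𝓡 n) p) (S.worldline x)
          (mfderiv (𝓡 (n + 1)) (𝓡 n) S.worldline x v), mvfderiv (𝓡 (n + 1)) S.time x v) := by
  have hfst := HasMFDerivAt.comp x (mdifferentiableAt_extChartAt (I := 𝓡 n)
    (extChartAt_source (𝓡 n) p ▸ hx)).hasMFDerivAt (S.mdifferentiableAt_worldline x).hasMFDerivAt
  have hsnd := (S.time_smooth.mdifferentiableAt (by simp) (x := x)).hasMFDerivAt
  have hcoords : HasMFDerivAt (𝓡 (n + 1)) 𝓘(ℝ, EuclideanSpace ℝ (Fin n) × ℝ) (S.coords p) x _ :=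
    ⟨hfst.1.prodMk hsnd.1, hfst.2.prodMk hsnd.2⟩
  exact DFunLike.congr_fun hcoords.mfderiv v

theorem isInvertible_mfderiv_coords :
    (mfderiv (𝓡 (n + 1)) 𝓘(ℝ, EuclideanSpace ℝ (Fin n) × ℝ) (S.coords p) x).IsInvertible := by
  obtain ⟨e, he⟩ := isInvertible_mfderiv_extChartAt (I := 𝓡 n) hx
  obtain ⟨e', he'⟩ := S.isInvertible_mfderiv_toProd x
  refine ⟨e'.trans (e.prodCongr (.refl ℝ ℝ)), ContinuousLinearMap.ext fun v => ?_⟩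
  have hv : e' v = _ := (DFunLike.congr_fun he' v).trans (S.mfderiv_toProd x v)
  refine Eq.trans ?_ (mfderiv_coords hx v).symm
  rw [← he]
  exact congrArg (e.prodCongr (.refl ℝ ℝ)) hv

theorem mpullback_coords_eq_dt :
    VectorField.mpullback (𝓡 (n + 1)) 𝓘(ℝ, EuclideanSpace ℝ (Fin n) × ℝ) (S.coords p)
      (fun _ => ((0 : EuclideanSpace ℝ (Fin n)), (1 : ℝ))) x = S.dt x := by
  refine (isInvertible_mfderiv_coords hx).injective
    (((isInvertible_mfderiv_coords hx).self_apply_inverse _).trans ?_)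
  rw [mfderiv_coords hx, S.mfderiv_worldline_dt, S.dt_time, map_zero]
  rfl

theorem mpullback_coords_eq_liftCoordField (a : EuclideanSpace ℝ (Fin n)) :
    VectorField.mpullback (𝓡 (n + 1)) 𝓘(ℝ, EuclideanSpace ℝ (Fin n) × ℝ) (S.coords p)
      (fun _ => (a, (0 : ℝ))) x = (S.liftCoordField p a x).1 := by
  refine (isInvertible_mfderiv_coords hx).injective
    (((isInvertible_mfderiv_coords hx).self_apply_inverse _).trans ?_)
  refine Eq.trans (Prod.ext ?_ (S.liftCoordField p a x).2.symm) (mfderiv_coords hx _).symm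
  exact ((congrArg _ (S.mfderiv_worldline_lift x _)).trans (mfderiv_coordField a hx)).symm

theorem mlieBracket_dt_liftCoordField (a : EuclideanSpace ℝ (Fin n)) :
    VectorField.mlieBracket (𝓡 (n + 1)) S.dt (fun z => (S.liftCoordField p a z).1) x = 0 := by
  have hsource : ∀ᶠ z in 𝓝 x, S.worldline z ∈ (extChartAt (𝓡 n) p).source :=
    S.continuous_worldline.continuousAt.preimage_mem_nhds
      ((isOpen_extChartAt_source p).mem_nhds hx)
  have hdt := hsource.mono fun z hz => mpullback_coords_eq_dt hz
  have hlift := hsource.mono fun z hz => mpullback_coords_eq_liftCoordField hz a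
  rw [← Filter.EventuallyEq.mlieBracket_vectorField_eq hdt hlift]
  exact mlieBracket_mpullback_const (contMDiffAt_coords hx) _ _

end Coords

section SliceParam

/-- The part of the chart at `p` whose worldlines exist at time `t`. -/
def sliceDomain (p : S.WorldlineSpace) (t : ℝ) : Set (EuclideanSpace ℝ (Fin n)) :=
  (extChartAt (𝓡 n) p).target ∩
    (extChartAt (𝓡 n) p).symm ⁻¹' ((fun q => (q, t)) ⁻¹' range S.toProd)

theorem isOpen_sliceDomain (p : S.WorldlineSpace) (t : ℝ) : IsOpen (S.sliceDomain p t) :=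
  (continuousOn_extChartAt_symm p).isOpen_inter_preimage (isOpen_extChartAt_target p)
    (S.isOpenMap_toProd.isOpen_range.preimage (by fun_prop))

variable [Nonempty 𝓜]

/-- The parametrization of the slice at time `t` by the chart at `p` of the space of worldlines. -/
def sliceParam (p : S.WorldlineSpace) (t : ℝ) (y : EuclideanSpace ℝ (Fin n)) : 𝓜 :=
  S.ofProd ((extChartAt (𝓡 n) p).symm y, t)

variable {S} {p : S.WorldlineSpace} {t : ℝ} {y : EuclideanSpace ℝ (Fin n)}

theorem worldline_sliceParam (hy : y ∈ S.sliceDomain p t) :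
    S.worldline (S.sliceParam p t y) = (extChartAt (𝓡 n) p).symm y :=
  congrArg Prod.fst (S.toProd_ofProd hy.2)

theorem time_sliceParam (hy : y ∈ S.sliceDomain p t) : S.time (S.sliceParam p t y) = t :=
  congrArg Prod.snd (S.toProd_ofProd hy.2)

variable (S p t) in
theorem contMDiffOn_sliceParam :
    ContMDiffOn (𝓡 n) (𝓡 (n + 1)) ∞ (S.sliceParam p t) (S.sliceDomain p t) :=
  S.contMDiffOn_ofProd.comp
    (((contMDiffOn_extChartAt_symm p).mono inter_subset_left).prodMk contMDiffOn_const)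
    fun _ hy => hy.2

theorem mfderiv_sliceParam (hy : y ∈ S.sliceDomain p t) (a : EuclideanSpace ℝ (Fin n)) :
    mfderiv (𝓡 n) (𝓡 (n + 1)) (S.sliceParam p t) y a
      = (S.lift (S.sliceParam p t y) (mfderiv (𝓡 n) (𝓡 n) (extChartAt (𝓡 n) p).symm y a)).1 := by
  have hnhds := (S.isOpen_sliceDomain p t).mem_nhds hy
  have hparam := (((S.contMDiffOn_sliceParam p t).contMDiffAt hnhds).mdifferentiableAt
    (by simp)).hasMFDerivAt
  have hworldline := (HasMFDerivAt.comp y (S.mdifferentiableAt_worldline _).hasMFDerivAt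
    hparam).mfderiv
  have htime := (HasMFDerivAt.comp y (S.time_smooth.mdifferentiableAt (by simp)).hasMFDerivAt
    hparam).mfderiv
  have hworldline_eq : S.worldline ∘ S.sliceParam p t =ᶠ[𝓝 y] (extChartAt (𝓡 n) p).symm :=
    Filter.eventually_of_mem hnhds fun _ hz => worldline_sliceParam hz
  have htime_eq : S.time ∘ S.sliceParam p t =ᶠ[𝓝 y] fun _ => t :=
    Filter.eventually_of_mem hnhds fun _ hz => time_sliceParam hz
  rw [hworldline_eq.mfderiv_eq] at hworldline
  rw [htime_eq.mfderiv_eq, mfderiv_const] at htime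
  have hspat := (DFunLike.congr_fun htime a).symm
  refine (congrArg Subtype.val (S.lift_mfderiv_worldline ⟨_, hspat⟩)).symm.trans ?_
  exact congrArg (fun v => (S.lift _ v).1) (DFunLike.congr_fun hworldline a).symm

theorem liftCoordField_sliceParam (hy : y ∈ S.sliceDomain p t) (a : EuclideanSpace ℝ (Fin n)) :
    (S.liftCoordField p a (S.sliceParam p t y)).1
      = mfderiv (𝓡 n) (𝓡 (n + 1)) (S.sliceParam p t) y a := by
  rw [mfderiv_sliceParam hy, ← coordField_extChartAt_symm a hy.1, liftCoordField,
    worldline_sliceParam hy]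

variable (S p t) in
theorem isSliceParam_sliceParam : S.IsSliceParam t (S.sliceDomain p t) (S.sliceParam p t) where
  isOpen := S.isOpen_sliceDomain p t
  smooth := S.contMDiffOn_sliceParam p t
  mem_slice _ hy := time_sliceParam hy
  immersion y hy a b hab := by
    have hlift := (mfderiv_sliceParam hy a).symm.trans (hab.trans (mfderiv_sliceParam hy b))
    exact (isInvertible_mfderiv_extChartAt_symm hy.1).injective
      (S.lift_injective _ (Subtype.ext hlift))

theorem paramCoeff_sliceParam (hy : y ∈ S.sliceDomain p t) :
    S.paramCoeff (S.sliceParam p t) y = chartCoeff (S.pushMetric t) p y := by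
  ext i j
  rw [paramCoeff, Matrix.of_apply, mfderiv_sliceParam hy, mfderiv_sliceParam hy]
  exact S.met_coe _ _

end SliceParam

section Flow

variable [Nonempty 𝓜] {S} {p : S.WorldlineSpace} {x : 𝓜}

theorem hasDerivAt_pushMetric_coordField (hx : S.worldline x ∈ (extChartAt (𝓡 n) p).source)
    (a b : EuclideanSpace ℝ (Fin n)) :
    HasDerivAt (fun s => S.pushMetric s (S.worldline x) (coordField (𝓡 n) p a (S.worldline x))
        (coordField (𝓡 n) p b (S.worldline x)))
      (S.lieDerivMetric (S.liftCoordField p a) (S.liftCoordField p b) x) (S.time x) := by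
  let f (z : 𝓜) : ℝ := S.g z (S.liftCoordField p a z) (S.liftCoordField p b z)
  have hopen : IsOpen (S.worldline ⁻¹' (extChartAt (𝓡 n) p).source) :=
    (isOpen_extChartAt_source p).preimage S.continuous_worldline
  have hf : MDifferentiableAt (𝓡 (n + 1)) 𝓘(ℝ, ℝ) f x :=
    ((S.g_smooth _ _ _ hopen (S.smoothFieldOn_liftCoordField p a)
      (S.smoothFieldOn_liftCoordField p b)).contMDiffAt (hopen.mem_nhds hx)).mdifferentiableAt
      (by simp)
  have hx_eq : S.ofProd (S.worldline x, S.time x) = x := S.ofProd_toProd x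
  have hderiv := hasDerivAt_comp_of_hasMFDerivAt (hx_eq.symm ▸ hf)
    (S.hasMFDerivAt_ofProd_worldline x)
  rw [S.lieDerivMetric_of_mlieBracket_eq_zero (mlieBracket_dt_liftCoordField hx a)
    (mlieBracket_dt_liftCoordField hx b)]
  refine (hderiv.congr_deriv ?_).congr_of_eventuallyEq ?_
  · rw [hx_eq]
  · filter_upwards [S.eventually_toProd_ofProd_worldline x] with s hs
    have hworldline : S.worldline (S.ofProd (S.worldline x, s)) = S.worldline x :=
      congrArg Prod.fst hs
    exact congrArg (fun q => S.g (S.ofProd (S.worldline x, s)) (S.lift _ (coordField (𝓡 n) p a q))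
      (S.lift _ (coordField (𝓡 n) p b q))) hworldline.symm

theorem RicciFlowEquation.lieDerivMetric_liftCoordField (hS : S.RicciFlowEquation)
    (hx : S.worldline x ∈ (extChartAt (𝓡 n) p).source) (a b : EuclideanSpace ℝ (Fin n)) :
    S.lieDerivMetric (S.liftCoordField p a) (S.liftCoordField p b) x
      = -2 * ricciCoord (chartCoeff (S.pushMetric (S.time x)) p)
          (extChartAt (𝓡 n) p (S.worldline x)) a b := by
  set t := S.time x
  set y := extChartAt (𝓡 n) p (S.worldline x)
  have hsymm : (extChartAt (𝓡 n) p).symm y = S.worldline x := (extChartAt (𝓡 n) p).left_inv hx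
  have hy : y ∈ S.sliceDomain p t :=
    ⟨(extChartAt (𝓡 n) p).map_source hx, x, Prod.ext hsymm.symm rfl⟩
  have hparam : S.sliceParam p t y = x := by
    rw [sliceParam, hsymm]
    exact S.ofProd_toProd x
  have hcoeff : S.paramCoeff (S.sliceParam p t) =ᶠ[𝓝 y] chartCoeff (S.pushMetric t) p :=
    Filter.eventually_of_mem ((S.isOpen_sliceDomain p t).mem_nhds hy)
      fun z hz => paramCoeff_sliceParam hz
  have hflow := hS t _ _ (S.isSliceParam_sliceParam p t) y hy _ _ _
    ((isOpen_extChartAt_source p).preimage S.continuous_worldline) (by rwa [hparam])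
    (S.smoothFieldOn_liftCoordField p a) (S.smoothFieldOn_liftCoordField p b) a b
    (liftCoordField_sliceParam hy a).symm (liftCoordField_sliceParam hy b).symm
  rwa [hparam, ricciCoord_congr hcoeff] at hflow

theorem RicciFlowEquation.hasDerivAt_pushMetric (hS : S.RicciFlowEquation) (x : 𝓜)
    (v w : TangentSpace (𝓡 n) (S.worldline x)) :
    HasDerivAt (fun s => S.pushMetric s (S.worldline x) v w)
      (-2 * ricci (S.pushMetric (S.time x)) (S.worldline x) v w) (S.time x) := by
  have hx := mem_extChartAt_source (I := 𝓡 n) (S.worldline x)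
  let D := mfderiv (𝓡 n) (𝓡 n) (extChartAt (𝓡 n) (S.worldline x)) (S.worldline x)
  have hderiv := (hasDerivAt_pushMetric_coordField hx (D v) (D w)).congr_deriv
    (hS.lieDerivMetric_liftCoordField hx (D v) (D w))
  rwa [coordField_mfderiv hx, coordField_mfderiv hx] at hderiv

theorem RicciFlowEquation.isRicciFlowOn_pushMetric (hS : S.RicciFlowEquation) :
    IsRicciFlowOn I (range S.toProd) S.pushMetric where
  isOpen := S.isOpenMap_toProd.isOpen_range
  subset := by
    rintro _ ⟨x, rfl⟩
    exact ⟨mem_univ _, S.time_mem x⟩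
  slice_nonempty t ht := by
    obtain ⟨x, rfl⟩ := S.time_range.superset ht
    exact ⟨S.worldline x, x, rfl⟩
  symm _ _ _ _ _ := S.g_symm _ _ _
  pos _ _ _ _ hv := S.g_pos _ _ ((map_ne_zero_iff _ (S.lift_injective _)).2 hv)
  smooth _ _ _ hW hX hY := S.contMDiffOn_pushMetric hW hX hY
  flow := by
    rintro _ _ ⟨x, hx⟩
    obtain ⟨rfl, rfl⟩ := Prod.mk.inj hx
    exact hS.hasDerivAt_pushMetric x

end Flow

end PreSpacetime

end RicciSpacetime

end

theorem mainTheorem4_general {n : ℕ} {𝓜 : Type u} [TopologicalSpace 𝓜]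
    [ChartedSpace (EuclideanSpace ℝ (Fin (n + 1))) 𝓜] [IsManifold (𝓡 (n + 1)) ∞ 𝓜]
    [T2Space 𝓜] [SecondCountableTopology 𝓜] [ConnectedSpace 𝓜] {I : Set ℝ}
    (S : RicciSpacetime.RicciFlowSpacetime n 𝓜 I)
    (hS : ∀ x, ∀ t ∈ I, S.time x ≤ t → t ∈ S.worldlineDomain x) :
    ∃ (M : Type u) (_ : TopologicalSpace M) (_ : ChartedSpace (EuclideanSpace ℝ (Fin n)) M)
      (_ : IsManifold (𝓡 n) ∞ M) (_ : T2Space M) (_ : SecondCountableTopology M)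
      (_ : ConnectedSpace M) (Φ : 𝓜 → M × ℝ)
      (h : ℝ → ∀ p : M, LinearMap.BilinForm ℝ (TangentSpace (𝓡 n) p)),
      (∀ x, (Φ x).2 ∈ I) ∧
      RicciSpacetime.IsDiffeoOntoOpenImageOn (𝓡 (n + 1)) ((𝓡 n).prod 𝓘(ℝ, ℝ)) univ Φ ∧
      (∀ t ∈ I,
        RicciSpacetime.IsDiffeoOntoOpenImageOn (𝓡 (n + 1)) (𝓡 n) (S.slice t)
          (fun x => (Φ x).1)) ∧
      (∀ x, (Φ x).2 = S.time x) ∧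
      (∀ x, mfderiv (𝓡 (n + 1)) ((𝓡 n).prod 𝓘(ℝ, ℝ)) Φ x (S.dt x)
        = ((0 : EuclideanSpace ℝ (Fin n)), (1 : ℝ))) ∧
      (∀ (x : 𝓜) (v w : RicciSpacetime.spat n S.time x),
        h (S.time x) (Φ x).1
          (mfderiv (𝓡 (n + 1)) (𝓡 n) (fun z => (Φ z).1) x v.1)
          (mfderiv (𝓡 (n + 1)) (𝓡 n) (fun z => (Φ z).1) x w.1) = S.g x v w) ∧
      RicciSpacetime.IsRicciFlowOn I (range Φ) h ∧
      (∀ p : M, ∃ x, (Φ x).1 = p) ∧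
      (∀ x y, (Φ x).1 = (Φ y).1 ↔ ∃ t, S.WorldlineAt x t y) :=
  have := RicciSpacetime.PreSpacetime.t2Space_worldlineSpace hS
  ⟨S.WorldlineSpace, inferInstance, inferInstance, inferInstance, inferInstance, inferInstance,
    inferInstance, S.toProd, S.pushMetric, S.time_mem, S.isDiffeoOntoOpenImageOn_toProd,
    fun t _ => S.isDiffeoOntoOpenImageOn_worldline_slice t, fun _ => rfl, S.mfderiv_toProd_dt,
    S.pushMetric_mfderiv, S.ricciFlow.isRicciFlowOn_pushMetric, S.worldline_surjective,
    fun _ _ => S.worldline_eq_iff⟩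

theorem mainTheorem4 {n : ℕ} {𝓜 : Type u} [TopologicalSpace 𝓜]
    [ChartedSpace (EuclideanSpace ℝ (Fin (n + 1))) 𝓜] [IsManifold (𝓡 (n + 1)) ∞ 𝓜]
    [T2Space 𝓜] [SecondCountableTopology 𝓜] [ConnectedSpace 𝓜] {T : EReal}
    (S : RicciSpacetime.RicciFlowSpacetime n 𝓜 (RicciSpacetime.timeInterval T))
    (hS : RicciSpacetime.IsExpanding S) :
    ∃ (M : Type u) (_ : TopologicalSpace M) (_ : ChartedSpace (EuclideanSpace ℝ (Fin n)) M)
      (_ : IsManifold (𝓡 n) ∞ M) (_ : T2Space M) (_ : SecondCountableTopology M)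
      (_ : ConnectedSpace M) (Φ : 𝓜 → M × ℝ)
      (h : ℝ → ∀ p : M, LinearMap.BilinForm ℝ (TangentSpace (𝓡 n) p)),
      -- `Φ` maps into `M × (0, T)` and is a diffeomorphism onto its (open) image
      (∀ x, (Φ x).2 ∈ RicciSpacetime.timeInterval T) ∧
      RicciSpacetime.IsDiffeoOntoOpenImageOn (𝓡 (n + 1)) ((𝓡 n).prod 𝓘(ℝ, ℝ)) univ Φ ∧
      -- each slice is mapped diffeomorphically onto its (open) image in `M × {t} = M`
      (∀ t ∈ RicciSpacetime.timeInterval T,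
        RicciSpacetime.IsDiffeoOntoOpenImageOn (𝓡 (n + 1)) (𝓡 n) (S.slice t)
          (fun x => (Φ x).1)) ∧
      -- `𝔱 = t ∘ Φ` and `Φ_* ∂_t = ∂/∂t`
      (∀ x, (Φ x).2 = S.time x) ∧
      (∀ x, mfderiv (𝓡 (n + 1)) ((𝓡 n).prod 𝓘(ℝ, ℝ)) Φ x (S.dt x)
        = ((0 : EuclideanSpace ℝ (Fin n)), (1 : ℝ))) ∧
      -- `h = Φ_* g` is a solution of the Ricci flow equation on `Φ(𝓜)`
      (∀ (x : 𝓜) (v w : RicciSpacetime.spat n S.time x),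
        h (S.time x) (Φ x).1
          (mfderiv (𝓡 (n + 1)) (𝓡 n) (fun z => (Φ z).1) x v.1)
          (mfderiv (𝓡 (n + 1)) (𝓡 n) (fun z => (Φ z).1) x w.1) = S.g x v w) ∧
      RicciSpacetime.IsRicciFlowOn (RicciSpacetime.timeInterval T) (range Φ) h ∧
      -- `M` is the direct limit of the slices along the flow of `∂_t`: the union of their images,
      -- two points having the same image exactly when they lie on a common worldline
      (∀ p : M, ∃ x, (Φ x).1 = p) ∧
      (∀ x y, (Φ x).1 = (Φ y).1 ↔ ∃ t, S.WorldlineAt x t y) := by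
  exact mainTheorem4_general S fun _ _ ht hxt => hS.mem_worldlineDomain ht.2 hxt
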